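/- Notation. For $n\ge 0$ let $Y(n)$ be the category whose objects are the complete parenthesizations of a word of slots in which each of the variables $1,\dots,n$ is placed in exactly one slot and all remaining slots are filled with the unit, and which has exactly one morphism between any two objects. It acts on every symmetric monoidal category $\mathcal C$: an object $t$ of $Y(n)$ gives a functor $t:\mathcal C^n\to\mathcal C$, and the unique morphism $s\to t$ gives the canonical natural isomorphism built from the associativity, unit and symmetry isomorphisms (well defined by coherence). $\Sigma_n$ acts on the right on $Y(n)$ by renaming variables, and $\gamma$ denotes substitution of words for variables; $1\in Y(1)$ is the single variable. Let $\kappa=(\kappa_n:\mathrm{Ob}\,\mathcal C^n\to\mathrm{Ob}\,Y(n))_{n\ge0}$ be an arbitrary sequence of functions and write $\overline\kappa x=\kappa_n(x)(x)$ for $x\in\mathrm{Ob}\,\mathcal C^n$. The underlying multicategory $U_\kappa\mathcal C$ has the objects of $\mathcal C$ as objects and the sets $U_\kappa\mathcal C(x;y)=\mathcal C(\overline\kappa x,y)$ of $n$-morphisms (regarded as disjoint for different source tuples $x$). The identity of $a$ is the canonical isomorphism $\overline\kappa(a)\to 1\cdot a=a$. For $\sigma\in\Sigma_n$, $\sigma^*:U_\kappa\mathcal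 C(x;y)\to U_\kappa\mathcal C(x_{\sigma(1)},\dots,x_{\sigma(n)};y)$ is precomposition with the canonical isomorphism $\overline\kappa(x\circ\sigma)\to(\kappa_n(x)\cdot\sigma)(x\circ\sigma)=\overline\kappa x$. The multicomposite of $f:\overline\kappa y\to z$ with $g_s:\overline\kappa x_s\to y_s$ $(1\le s\le n)$ is $$\overline\kappa(x_1\odot\cdots\odot x_n)\to\gamma(\kappa_n(y);\kappa(x_1),\dots,\kappa(x_n))(x_1\odot\cdots\odot x_n)=\kappa_n(y)(\overline\kappa x_1,\dots,\overline\kappa x_n)\xrightarrow{\kappa_n(y)(g_1,\dots,g_n)}\overline\kappa y\xrightarrow{f}z,$$ where $\odot$ is concatenation and the first map is canonical. Multicategories have symmetric group actions, and multifunctors preserve identities, multicomposition and these actions. **Theorem.** Let $\mathcal C$ and $\mathcal D$ be symmetric monoidal categories, with arbitrary choices $U\mathcal C=U_\kappa\mathcal C$ and $U\mathcal D=U_\nu\mathcal D$. Then: 1. $U\mathcal C$ and $U\mathcal D$ are multicategories. For each lax symmetric monoidal functor $F:\mathcal C\to\mathcal D$ there is a multifunctor $UF:U\mathcal C\to U\mathcal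 D$ which is $F$ on objects and sends $f\in\mathcal C(\overline\kappa x,y)$ to the composite $$\overline\nu(Fx)\to\kappa_n(x)(Fx)\to F(\overline\kappa x)\xrightarrow{Ff}Fy,$$ where $Fx=(Fx_1,\dots,Fx_n)$, the first map is the canonical isomorphism, and the second is built from the structure maps $e_{\mathcal D}\to Fe_{\mathcal C}$ and $Fa\oplus Fb\to F(a\oplus b)$ of $F$ following the word $\kappa_n(x)$. The assignment $F\mapsto UF$ is a bijection from lax symmetric monoidal functors $\mathcal C\to\mathcal D$ to multifunctors $U\mathcal C\to U\mathcal D$. 2. For any choice of a sequence $\kappa^{\mathcal C}$ for every symmetric monoidal category $\mathcal C$, the assignments $\mathcal C\mapsto U_{\kappa^{\mathcal C}}\mathcal C$ and $F\mapsto UF$ form a fully faithful functor from the category of symmetric monoidal categories and lax symmetric monoidal functors to the category of multicategories and multifunctors. -/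

import Mathlib

open CategoryTheory MonoidalCategory

universe u v u₁ v₁ u₂ v₂

namespace SymMult

/-! ## Multicategories (symmetric, with `Σₙ`-actions) and multifunctors -/

/-- Concatenation `x₁ ⊙ ⋯ ⊙ xₙ` of the tuples `x_s` of length `k s`. -/
def concat {α : Type*} {n : ℕ} {k : Fin n → ℕ} (x : ∀ s, Fin (k s) → α) :
    Fin (∑ s, k s) → α :=
  fun p => x (finSigmaFinEquiv.symm p).1 (finSigmaFinEquiv.symm p).2

/-- The data of a multicategory: objects, sets `Hom x y` of `n`-morphisms from an `n`-tuple `x` to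
an object `y`, identities, the right actions of the symmetric groups, and the multicomposition. -/
structure MulticategoryData where
  /-- the objects -/
  Obj : Type u
  /-- the `n`-morphisms `(x₁, …, xₙ) → y` -/
  Hom : {n : ℕ} → (Fin n → Obj) → Obj → Type v
  /-- the identity, a 1-morphism -/
  ident : ∀ a : Obj, Hom (fun _ : Fin 1 => a) a
  /-- `σ* : Hom (x₁, …, xₙ; y) → Hom (x_{σ(1)}, …, x_{σ(n)}; y)` -/
  perm : ∀ {n : ℕ} {x : Fin n → Obj} {y : Obj} (σ : Equiv.Perm (Fin n)),
    Hom x y → Hom (x ∘ σ) y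
  /-- the multicomposition `Γ` -/
  comp : ∀ {n : ℕ} {k : Fin n → ℕ} {x : ∀ s, Fin (k s) → Obj} {y : Fin n → Obj} {z : Obj},
    Hom y z → (∀ s, Hom (x s) (y s)) → Hom (concat x) z

namespace MulticategoryData

variable (M : MulticategoryData.{u, v})

/-- All morphisms with target `z`, of all arities and with all sources. -/
def MorTo (z : M.Obj) : Type (max u v) := Σ n : ℕ, Σ x : Fin n → M.Obj, M.Hom x z

variable {M} in
/-- A morphism together with its arity and source. An equation `mor f = mor g` says that `f` and `g`
have the same arity, the same source and are equal; it is used for equations between morphisms whose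
arities are equal numbers, but not by definition. -/
def mor {n : ℕ} {x : Fin n → M.Obj} {z : M.Obj} (f : M.Hom x z) : M.MorTo z := ⟨n, x, f⟩

end MulticategoryData

/-- The permutation `τ₁ ⊕ ⋯ ⊕ τₙ` of `k₁ + ⋯ + kₙ` letters. -/
def sumPerm {n : ℕ} {k : Fin n → ℕ} (τ : ∀ s, Equiv.Perm (Fin (k s))) :
    Equiv.Perm (Fin (∑ s, k s)) :=
  finSigmaFinEquiv.symm.trans ((Equiv.sigmaCongrRight τ).trans finSigmaFinEquiv)

/-- The permutation `σ⟨k_{σ(1)}, …, k_{σ(n)}⟩`, which takes the `r`-th letter of the `s`-th block,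
for blocks of lengths `k_{σ(1)}, …, k_{σ(n)}`, to the `r`-th letter of the `σ(s)`-th block,
for blocks of lengths `k₁, …, kₙ`. -/
def blockPerm {n : ℕ} (σ : Equiv.Perm (Fin n)) (k : Fin n → ℕ) :
    Equiv.Perm (Fin (∑ s, k s)) :=
  (finCongr (Equiv.sum_comp σ k)).symm.trans
    ((finSigmaFinEquiv (n := fun s => k (σ s))).symm.trans
      ((Equiv.sigmaCongrLeft (β := fun s => Fin (k s)) σ).trans finSigmaFinEquiv))

open MulticategoryData in
/-- The axioms of a multicategory: right actions of the symmetric groups, associativity, units, and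
the two equivariance axioms. -/
structure IsMulticategory (M : MulticategoryData.{u, v}) : Prop where
  perm_one : ∀ {n : ℕ} {x : Fin n → M.Obj} {y : M.Obj} (f : M.Hom x y), M.perm 1 f = f
  perm_mul : ∀ {n : ℕ} {x : Fin n → M.Obj} {y : M.Obj} (σ τ : Equiv.Perm (Fin n)) (f : M.Hom x y),
    M.perm (σ * τ) f = M.perm τ (M.perm σ f)
  ident_comp : ∀ {n : ℕ} {x : Fin n → M.Obj} {y : M.Obj} (f : M.Hom x y),
    mor (M.comp (M.ident y) (fun _ : Fin 1 => f)) = mor f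
  comp_ident : ∀ {n : ℕ} {x : Fin n → M.Obj} {y : M.Obj} (f : M.Hom x y),
    mor (M.comp f (fun s => M.ident (x s))) = mor f
  assoc : ∀ {n : ℕ} {k : Fin n → ℕ} {l : ∀ s, Fin (k s) → ℕ}
    {w : ∀ s r, Fin (l s r) → M.Obj} {x : ∀ s, Fin (k s) → M.Obj} {y : Fin n → M.Obj} {z : M.Obj}
    (f : M.Hom y z) (g : ∀ s, M.Hom (x s) (y s)) (h : ∀ s r, M.Hom (w s r) (x s r)),
    mor (M.comp (M.comp f g)
      (fun p => h (finSigmaFinEquiv.symm p).1 (finSigmaFinEquiv.symm p).2)) =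
    mor (M.comp f (fun s => M.comp (g s) (h s)))
  perm_comp : ∀ {n : ℕ} {k : Fin n → ℕ} {x : ∀ s, Fin (k s) → M.Obj} {y : Fin n → M.Obj}
    {z : M.Obj} (σ : Equiv.Perm (Fin n)) (f : M.Hom y z) (g : ∀ s, M.Hom (x s) (y s)),
    mor (M.comp (M.perm σ f) (fun s => g (σ s))) = mor (M.perm (blockPerm σ k) (M.comp f g))
  comp_perm : ∀ {n : ℕ} {k : Fin n → ℕ} {x : ∀ s, Fin (k s) → M.Obj} {y : Fin n → M.Obj}
    {z : M.Obj} (τ : ∀ s, Equiv.Perm (Fin (k s))) (f : M.Hom y z) (g : ∀ s, M.Hom (x s) (y s)),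
    mor (M.comp f (fun s => M.perm (τ s) (g s))) = mor (M.perm (sumPerm τ) (M.comp f g))

/-- A map on objects together with maps on `n`-morphisms for all `n`, without any axioms. -/
@[ext]
structure MultiMap (M : MulticategoryData.{u₁, v₁}) (N : MulticategoryData.{u₂, v₂}) where
  /-- the map on objects -/
  obj : M.Obj → N.Obj
  /-- the map on `n`-morphisms -/
  map : ∀ {n : ℕ} {x : Fin n → M.Obj} {y : M.Obj}, M.Hom x y → N.Hom (obj ∘ x) (obj y)

/-- The identity map. -/
def MultiMap.ident (M : MulticategoryData.{u, v}) : MultiMap M M where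
  obj := fun a => a
  map := fun f => f

/-- The composite of two maps, in diagrammatic order. -/
def MultiMap.comp {L M N : MulticategoryData.{u, v}} (φ : MultiMap L M) (ψ : MultiMap M N) :
    MultiMap L N where
  obj := ψ.obj ∘ φ.obj
  map := fun f => ψ.map (φ.map f)

/-- The axioms of a multifunctor: identities, multicomposition and the symmetric group actions are
preserved. -/
structure IsMultifunctor {M : MulticategoryData.{u₁, v₁}} {N : MulticategoryData.{u₂, v₂}}
    (φ : MultiMap M N) : Prop where
  map_ident : ∀ a : M.Obj, φ.map (M.ident a) = N.ident (φ.obj a)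
  map_perm : ∀ {n : ℕ} {x : Fin n → M.Obj} {y : M.Obj} (σ : Equiv.Perm (Fin n)) (f : M.Hom x y),
    φ.map (M.perm σ f) = N.perm σ (φ.map f)
  map_comp : ∀ {n : ℕ} {k : Fin n → ℕ} {x : ∀ s, Fin (k s) → M.Obj} {y : Fin n → M.Obj}
    {z : M.Obj} (f : M.Hom y z) (g : ∀ s, M.Hom (x s) (y s)),
    φ.map (M.comp f g) = N.comp (x := fun s => φ.obj ∘ x s) (φ.map f) (fun s => φ.map (g s))

/-- Multifunctors. -/
@[ext]
structure Multifunctor (M : MulticategoryData.{u₁, v₁}) (N : MulticategoryData.{u₂, v₂}) where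
  /-- the underlying maps on objects and morphisms -/
  toMultiMap : MultiMap M N
  isMultifunctor : IsMultifunctor toMultiMap

/-- Multicategories. -/
structure Multicat where
  /-- the objects, morphisms and operations -/
  data : MulticategoryData.{u, v}
  isMulticategory : IsMulticategory data

/-- The category of multicategories and multifunctors. -/
instance : Category Multicat.{u, v} where
  Hom M N := Multifunctor M.data N.data
  id M := ⟨MultiMap.ident M.data, ⟨fun _ => rfl, fun _ _ => rfl, fun _ _ => rfl⟩⟩
  comp φ ψ := ⟨φ.toMultiMap.comp ψ.toMultiMap,
    { map_ident := fun a =>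
        (congrArg ψ.toMultiMap.map (φ.isMultifunctor.map_ident a)).trans
          (ψ.isMultifunctor.map_ident _)
      map_perm := fun σ f =>
        (congrArg ψ.toMultiMap.map (φ.isMultifunctor.map_perm σ f)).trans
          (ψ.isMultifunctor.map_perm σ _)
      map_comp := fun f g =>
        (congrArg ψ.toMultiMap.map (φ.isMultifunctor.map_comp f g)).trans
          (ψ.isMultifunctor.map_comp _ _) }⟩

/-! ## The categorical operad `Y` of symmetric monoidal categories -/

/-- Parenthesized words: every leaf is a letter of `ι` or a slot filled with the unit object. -/
inductive Word (ι : Type) : Type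
  | unit : Word ι
  | var : ι → Word ι
  | mul : Word ι → Word ι → Word ι

namespace Word

variable {ι ι' : Type}

/-- The letters of a word, from left to right. -/
def letters : Word ι → List ι
  | unit => []
  | var i => [i]
  | mul s t => s.letters ++ t.letters

/-- Substitute a word for each letter. -/
def subst (w : ι → Word ι') : Word ι → Word ι'
  | unit => unit
  | var i => w i
  | mul s t => mul (s.subst w) (t.subst w)

/-- Rename the letters. -/
def rename (f : ι → ι') (t : Word ι) : Word ι' := t.subst (fun i => var (f i))

/-- The object of a monoidal category obtained from a word by inserting objects for the letters. -/
def eval {C : Type u} [Category.{v} C] [MonoidalCategory C] (x : ι → C) : Word ι → C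
  | unit => 𝟙_ C
  | var i => x i
  | mul s t => s.eval x ⊗ t.eval x

/-- Every letter of `ι` occurs exactly once. -/
def IsLinear (t : Word ι) : Prop := t.letters.Nodup ∧ ∀ i, i ∈ t.letters

theorem letters_subst (w : ι → Word ι') (t : Word ι) :
    (t.subst w).letters = t.letters.flatMap (fun i => (w i).letters) := by
  induction t with
  | unit => rfl
  | var i => simp [subst, letters]
  | mul s t hs ht => simp [subst, letters, hs, ht]

theorem letters_rename (f : ι → ι') (t : Word ι) : (t.rename f).letters = t.letters.map f := by
  induction t with
  | unit => rfl
  | var i => rfl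
  | mul s t hs ht => simp_all [rename, subst, letters]

theorem eval_subst {C : Type u} [Category.{v} C] [MonoidalCategory C] (x : ι' → C)
    (w : ι → Word ι') (t : Word ι) : (t.subst w).eval x = t.eval (fun i => (w i).eval x) := by
  induction t with
  | unit => rfl
  | var i => rfl
  | mul s t hs ht => simp only [subst, eval, hs, ht]

/-- A word acts on morphisms. -/
def evalMap {C : Type u} [Category.{v} C] [MonoidalCategory C] {x y : ι → C} (f : ∀ i, x i ⟶ y i) :
    (t : Word ι) → (t.eval x ⟶ t.eval y)
  | unit => 𝟙 (𝟙_ C)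
  | var i => f i
  | mul s t => s.evalMap f ⊗ₘ t.evalMap f

end Word

/-- Formal composites of the structure isomorphisms of symmetric monoidal categories. -/
inductive Coh {ι : Type} : Word ι → Word ι → Type
  | ident (s : Word ι) : Coh s s
  | comp {s t w : Word ι} : Coh s t → Coh t w → Coh s w
  | tensor {s s' t t' : Word ι} : Coh s s' → Coh t t' → Coh (.mul s t) (.mul s' t')
  | assoc (s t w : Word ι) : Coh (.mul (.mul s t) w) (.mul s (.mul t w))
  | assocInv (s t w : Word ι) : Coh (.mul s (.mul t w)) (.mul (.mul s t) w)
  | leftUnit (s : Word ι) : Coh (.mul .unit s) s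
  | leftUnitInv (s : Word ι) : Coh s (.mul .unit s)
  | rightUnit (s : Word ι) : Coh (.mul s .unit) s
  | rightUnitInv (s : Word ι) : Coh s (.mul s .unit)
  | braid (s t : Word ι) : Coh (.mul s t) (.mul t s)

namespace Coh

variable {ι : Type}

/-- The isomorphism of a symmetric monoidal category that a formal composite stands for. -/
def eval {C : Type u} [Category.{v} C] [MonoidalCategory C] [SymmetricCategory C] (x : ι → C) :
    {s t : Word ι} → Coh s t → (s.eval x ⟶ t.eval x)
  | _, _, ident s => 𝟙 (s.eval x)
  | _, _, comp f g => f.eval x ≫ g.eval x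
  | _, _, tensor f g => f.eval x ⊗ₘ g.eval x
  | _, _, assoc s t w => (α_ (s.eval x) (t.eval x) (w.eval x)).hom
  | _, _, assocInv s t w => (α_ (s.eval x) (t.eval x) (w.eval x)).inv
  | _, _, leftUnit s => (λ_ (s.eval x)).hom
  | _, _, leftUnitInv s => (λ_ (s.eval x)).inv
  | _, _, rightUnit s => (ρ_ (s.eval x)).hom
  | _, _, rightUnitInv s => (ρ_ (s.eval x)).inv
  | _, _, braid s t => (β_ (s.eval x) (t.eval x)).hom

/-- Reversal of a formal composite. -/
def symm : {s t : Word ι} → Coh s t → Coh t s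
  | _, _, ident s => ident s
  | _, _, comp f g => comp g.symm f.symm
  | _, _, tensor f g => tensor f.symm g.symm
  | _, _, assoc s t w => assocInv s t w
  | _, _, assocInv s t w => assoc s t w
  | _, _, leftUnit s => leftUnitInv s
  | _, _, leftUnitInv s => leftUnit s
  | _, _, rightUnit s => rightUnitInv s
  | _, _, rightUnitInv s => rightUnit s
  | _, _, braid s t => braid t s

/-- The word `i₁(i₂(⋯(iₘ 1)))` on a list of letters. -/
def ofList : List ι → Word ι
  | [] => .unit
  | i :: l => .mul (.var i) (ofList l)

/-- Juxtaposition of lists. -/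
def append : (l m : List ι) → Coh (.mul (ofList l) (ofList m)) (ofList (l ++ m))
  | [], m => leftUnit (ofList m)
  | i :: l, m => comp (assoc (.var i) (ofList l) (ofList m)) (tensor (ident _) (append l m))

/-- Every word is connected to the standard word on its letters. -/
def normalize : (t : Word ι) → Coh t (ofList t.letters)
  | .unit => ident _
  | .var i => rightUnitInv (.var i)
  | .mul s t => comp (tensor (normalize s) (normalize t)) (append s.letters t.letters)

theorem nonempty_of_perm {l m : List ι} (h : l.Perm m) : Nonempty (Coh (ofList l) (ofList m)) := by
  induction h with
  | nil => exact ⟨ident _⟩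
  | cons i _ ih => exact ih.map (fun f => tensor (ident _) f)
  | swap i j l =>
    exact ⟨comp (assocInv _ _ _) (comp (tensor (braid _ _) (ident _)) (assoc _ _ _))⟩
  | trans _ _ ih₁ ih₂ => exact ih₁.elim fun f => ih₂.map (fun g => comp f g)

end Coh

/-- The objects of `Y(n)`: complete parenthesizations of at least `n` slots, with the `n` variables
inserted into `n` of the slots in some order, and units in the other slots. -/
def Y (n : ℕ) : Type := {t : Word (Fin n) // t.IsLinear}

namespace Y

/-- The identity object `1 ∈ Y(1)`. -/
def one : Y 1 := ⟨.var 0, by simp [Word.letters], by simp [Word.letters, Fin.forall_fin_one]⟩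

/-- The right action of `Σₙ` on the objects of `Y(n)`. -/
def act {n : ℕ} (t : Y n) (σ : Equiv.Perm (Fin n)) : Y n :=
  ⟨t.1.rename σ.symm, by
    refine ⟨?_, fun i => ?_⟩
    · rw [Word.letters_rename]
      exact t.2.1.map σ.symm.injective
    · rw [Word.letters_rename]
      exact List.mem_map.2 ⟨σ i, t.2.2 _, by simp⟩⟩

/-- The operad composition `γ(t; s₁, …, sₙ)` on objects. -/
def gamma {n : ℕ} {k : Fin n → ℕ} (t : Y n) (s : ∀ i, Y (k i)) : Y (∑ i, k i) :=
  ⟨t.1.subst (fun i => (s i).1.rename (fun r => finSigmaFinEquiv ⟨i, r⟩)), by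
    have key : ∀ i : Fin n, ((s i).1.rename (fun r => finSigmaFinEquiv (n := k) ⟨i, r⟩)).letters =
        (s i).1.letters.map (fun r => finSigmaFinEquiv ⟨i, r⟩) :=
      fun i => Word.letters_rename _ _
    refine ⟨?_, fun p => ?_⟩
    · rw [Word.letters_subst, List.nodup_flatMap]
      refine ⟨fun i _ => ?_, t.2.1.imp fun {i j} hij => ?_⟩
      · rw [key]
        exact (s i).2.1.map fun a b hab => by simpa using hab
      · intro p hi hj
        simp only [key, List.mem_map] at hi hj
        obtain ⟨a, -, rfl⟩ := hi
        obtain ⟨b, -, hb⟩ := hj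
        have := finSigmaFinEquiv.injective hb
        exact hij (congrArg Sigma.fst this).symm
    · rw [Word.letters_subst, List.mem_flatMap]
      refine ⟨(finSigmaFinEquiv.symm p).1, t.2.2 _, ?_⟩
      rw [key]
      exact List.mem_map.2 ⟨(finSigmaFinEquiv.symm p).2, (s _).2.2 _, by simp⟩⟩

theorem nonempty_coh {n : ℕ} (s t : Y n) : Nonempty (Coh s.1 t.1) :=
  (Coh.nonempty_of_perm
    ((List.perm_ext_iff_of_nodup s.2.1 t.2.1).2 fun i => ⟨fun _ => t.2.2 i, fun _ => s.2.2 i⟩)).map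
    fun f => .comp (Coh.normalize s.1) (.comp f (Coh.normalize t.1).symm)

section Action

variable {C : Type u} [Category.{v} C] [MonoidalCategory C]

/-- The action of an object of `Y(n)` on an `n`-tuple of objects of `C`. -/
def obj {n : ℕ} (t : Y n) (x : Fin n → C) : C := t.1.eval x

/-- The action of an object of `Y(n)` on an `n`-tuple of morphisms of `C`. -/
def map {n : ℕ} (t : Y n) {x y : Fin n → C} (f : ∀ i, x i ⟶ y i) : t.obj x ⟶ t.obj y :=
  t.1.evalMap f

theorem obj_one (a : C) : one.obj (fun _ => a) = a := rfl

theorem obj_act {n : ℕ} (t : Y n) (σ : Equiv.Perm (Fin n)) (x : Fin n → C) :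
    (t.act σ).obj (x ∘ σ) = t.obj x := by
  simp [obj, act, Word.rename, Word.eval_subst, Word.eval]

theorem obj_gamma {n : ℕ} {k : Fin n → ℕ} (t : Y n) (s : ∀ i, Y (k i)) (x : ∀ i, Fin (k i) → C) :
    (t.gamma s).obj (concat x) = t.obj (fun i => (s i).obj (x i)) := by
  have h : ∀ i r, concat x (finSigmaFinEquiv ⟨i, r⟩) = x i r := fun i r =>
    congrArg (fun q : (Σ i, Fin (k i)) => x q.1 q.2)
      (finSigmaFinEquiv.symm_apply_apply (⟨i, r⟩ : Σ i, Fin (k i)))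
  simp [obj, gamma, Word.rename, Word.eval_subst, Word.eval, h]

/-- The action on `x` of the unique morphism `s ⟶ t` of `Y(n)`: the canonical isomorphism built from
associativity, unit and commutativity isomorphisms. By the coherence theorem for symmetric monoidal
categories it does not depend on the formal composite that is chosen here. -/
noncomputable def canon [SymmetricCategory C] {n : ℕ} (s t : Y n) (x : Fin n → C) :
    s.obj x ⟶ t.obj x :=
  (nonempty_coh s t).some.eval x

end Action

end Y

/-! ## Underlying multicategories -/

/-- A sequence of functions `κₙ : Ob Cⁿ → Ob Y(n)`, for `n ≥ 0`. -/
def Choice (C : Type u) : Type u := ∀ n : ℕ, (Fin n → C) → Y n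

section Underlying

variable {C : Type u} [Category.{v} C] [MonoidalCategory C]

/-- The object `κₙ(x)(x)`. -/
def Choice.bar (κ : Choice C) {n : ℕ} (x : Fin n → C) : C := (κ n x).obj x

/-- The underlying multicategory `U_κ C`, with `U_κ C(x; y) = C(κₙ(x)(x), y)`. -/
noncomputable def U [SymmetricCategory C] (κ : Choice C) : MulticategoryData.{u, v} where
  Obj := C
  Hom x y := κ.bar x ⟶ y
  ident a := Y.canon (κ 1 fun _ => a) Y.one (fun _ => a)
  perm {n x _} σ f :=
    Y.canon (κ n (x ∘ σ)) ((κ n x).act σ) (x ∘ σ) ≫ eqToHom (Y.obj_act (κ n x) σ x) ≫ f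
  comp {n k x y _} f g :=
    Y.canon (κ _ (concat x)) ((κ n y).gamma fun s => κ (k s) (x s)) (concat x) ≫
      eqToHom (Y.obj_gamma (κ n y) (fun s => κ (k s) (x s)) x) ≫ (κ n y).map g ≫ f

end Underlying

/-! ## Lax symmetric monoidal functors -/

section Lax

variable {C : Type u₁} [Category.{v₁} C] [MonoidalCategory C]
variable {D : Type u₂} [Category.{v₂} D] [MonoidalCategory D]

/-- The natural map `t(F x₁, …, F xₙ) ⟶ F (t(x₁, …, xₙ))` built from the structure maps
`ε : 1 ⟶ F 1` and `μ : F a ⊗ F b ⟶ F (a ⊗ b)` of a lax monoidal functor. -/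
def laxWord (F : C ⥤ D) [F.LaxMonoidal] {ι : Type} (x : ι → C) :
    (t : Word ι) → (t.eval (F.obj ∘ x) ⟶ F.obj (t.eval x))
  | .unit => Functor.LaxMonoidal.ε F
  | .var i => 𝟙 (F.obj (x i))
  | .mul s t => (laxWord F x s ⊗ₘ laxWord F x t) ≫ Functor.LaxMonoidal.μ F (s.eval x) (t.eval x)

variable [SymmetricCategory C] [SymmetricCategory D]

/-- The map `U_κ C → U_ν D` induced by a lax symmetric monoidal functor `F : C → D`. On objects it is
`F`; a morphism `f : κₙ(x)(x) ⟶ y` goes to the composite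
`νₙ(Fx)(Fx) ⟶ κₙ(x)(Fx) ⟶ F (κₙ(x)(x)) ⟶ F y`
of the canonical isomorphism, the map built from the lax structure of `F`, and `F f`. -/
noncomputable def laxMap (κ : Choice C) (ν : Choice D) (F : LaxBraidedFunctor C D) :
    MultiMap (U κ) (U ν) where
  obj := F.obj
  map {n x _} f :=
    Y.canon (ν n (F.obj ∘ x)) (κ n x) (F.obj ∘ x) ≫
      laxWord F.toFunctor x (κ n x).1 ≫ F.map f

end Lax

theorem laxBraidedFunctor_ext {C : Type u₁} [Category.{v₁} C] [MonoidalCategory C]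
    [SymmetricCategory C] {D : Type u₂} [Category.{v₂} D] [MonoidalCategory D]
    [SymmetricCategory D] {F : C ⥤ D} {h h' : F.LaxBraided}
    (hε : h.ε = h'.ε) (hμ : h.μ = h'.μ) :
    (⟨F, h⟩ : LaxBraidedFunctor C D) = ⟨F, h'⟩ := by
  rcases h with @⟨⟨ε, μ⟩, _⟩
  rcases h' with @⟨⟨ε', μ'⟩, _⟩
  obtain rfl : ε = ε' := hε
  obtain rfl : μ = μ' := hμ
  rfl

/-- Symmetric monoidal categories. -/
structure SymMonCat where
  /-- the objects -/
  carrier : Type u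
  [cat : Category.{v} carrier]
  [mon : MonoidalCategory carrier]
  [sym : SymmetricCategory carrier]

attribute [instance] SymMonCat.cat SymMonCat.mon SymMonCat.sym

/-- The category of symmetric monoidal categories and lax symmetric monoidal functors. -/
instance : Category SymMonCat.{u, v} where
  Hom C D := LaxBraidedFunctor C.carrier D.carrier
  id C := LaxBraidedFunctor.of (𝟭 C.carrier)
  comp F G := LaxBraidedFunctor.of (F.toFunctor ⋙ G.toFunctor)
  id_comp F := laxBraidedFunctor_ext (F := F.toFunctor)
    (by change F.laxBraided.ε ≫ F.map (𝟙 _) = _; simp)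
    (by funext X Y; change F.laxBraided.μ X Y ≫ F.map (𝟙 _) = _; simp)
  comp_id F := laxBraidedFunctor_ext (F := F.toFunctor)
    (Category.id_comp _) (by funext X Y; exact Category.id_comp _)
  assoc F G H := laxBraidedFunctor_ext (F := F.toFunctor ⋙ G.toFunctor ⋙ H.toFunctor)
    (by
      change H.laxBraided.ε ≫ H.map (G.laxBraided.ε ≫ G.map F.laxBraided.ε) =
        (H.laxBraided.ε ≫ H.map G.laxBraided.ε) ≫ H.map (G.map F.laxBraided.ε)
      simp)
    (by
      funext X Y
      change H.laxBraided.μ _ _ ≫ H.map (G.laxBraided.μ _ _ ≫ G.map (F.laxBraided.μ X Y)) =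
        (H.laxBraided.μ _ _ ≫ H.map (G.laxBraided.μ _ _)) ≫ H.map (G.map (F.laxBraided.μ X Y))
      simp)

/-- The functor `C ↦ U_{κ(C)} C`, `F ↦ laxMap F`, from symmetric monoidal categories and lax symmetric
monoidal functors to multicategories and multifunctors, for a choice `κ(C)` for each `C`, once it is
known that the values are multicategories and multifunctors, and that identities and composites are
preserved. -/
noncomputable def underlyingFunctor (κ : ∀ C : SymMonCat.{u, v}, Choice C.carrier)
    (hU : ∀ C : SymMonCat.{u, v}, IsMulticategory (U (κ C)))
    (hF : ∀ {C D : SymMonCat.{u, v}} (F : C ⟶ D), IsMultifunctor (laxMap (κ C) (κ D) F))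
    (hid : ∀ C : SymMonCat.{u, v}, laxMap (κ C) (κ C) (𝟙 C) = MultiMap.ident (U (κ C)))
    (hcomp : ∀ {C D E : SymMonCat.{u, v}} (F : C ⟶ D) (G : D ⟶ E),
      laxMap (κ C) (κ E) (F ≫ G) = (laxMap (κ C) (κ D) F).comp (laxMap (κ D) (κ E) G)) :
    SymMonCat.{u, v} ⥤ Multicat.{u, v} where
  obj C := ⟨U (κ C), hU C⟩
  map F := ⟨laxMap _ _ F, hF F⟩
  map_id C := Multifunctor.ext (hid C)
  map_comp F G := Multifunctor.ext (hcomp F G)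

end SymMult

namespace SymMult

/-! ## Coherence for symmetric monoidal categories -/

section TensorLemmas

variable {C : Type u} [Category.{v} C]

/-! Everything rests on coherence: between words without repeated letters there is at most one
canonical isomorphism (`Coh.eval_eq`). Every word is normalized to the right-bracketed product of
its letters. Conjugated by the normalizations, each structure isomorphism becomes a sorting symmetry
(`IsSort`), which brings the letters to the front one at a time in the target order. Without
repeated letters such a symmetry is determined by the two lists. Sorting symmetries are closed under
composition, because adjacent exchanges are involutions and satisfy the Yang–Baxter equation, and
under inversion and juxtaposition (`IsSort.trans`, `IsSort.symm`, `IsSort.append`).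

The choice `κ` only selects one word for each source tuple. The relation `Rep` removes it: a
multimorphism may be represented by a morphism on any word whose letters, in any alphabet, enumerate
its inputs, and either one then determines the other. Permuting inputs changes only the enumeration
(`Rep.perm`), and multicomposition is substitution of words (`Rep.comp`). An axiom of a
multicategory therefore follows once both sides are represented by the same morphism on the same
word. A lax symmetric monoidal functor acts on representing morphisms by `laxWord` followed by `F`
(`Rep.laxMap`), whatever the choices, and so gives a multifunctor.

Conversely, a multifunctor `φ` acts on representing morphisms (`Carries`), since equivariance makes
the action independent of the enumeration. Its values on one-letter words, on the identity of the
unit word and on the identity of a two-letter product are the functor, the unit map and the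
tensorator. Each lax symmetric monoidal axiom holds because both of its sides represent the image of
one and the same morphism. As words are built from units, letters and products, these data determine
`φ`, which makes the two constructions mutually inverse. -/

theorem comp_inverse_of_inverse {a b c : C} {f : a ⟶ b} {f' : b ⟶ a} {g : b ⟶ c} {g' : c ⟶ b}
    (hf : f ≫ f' = 𝟙 a) (hg : g ≫ g' = 𝟙 b) : (f ≫ g) ≫ g' ≫ f' = 𝟙 a := by
  rw [Category.assoc, reassoc_of% hg, hf]

theorem comp_comp_of_comp {a b c a' b' c' : C} {f : a ⟶ b} {g : b ⟶ c} {p : a ⟶ a'} {q : b ⟶ b'}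
    {r : c ⟶ c'} {h : a' ⟶ b'} {h' : b' ⟶ c'} (E : f ≫ q = p ≫ h) (E' : g ≫ r = q ≫ h') :
    (f ≫ g) ≫ r = p ≫ h ≫ h' := by
  rw [Category.assoc, E', reassoc_of% E]

variable [MonoidalCategory C]

theorem leftUnitor_naturality' {s t : C} (f : s ⟶ t) :
    (𝟙 (𝟙_ C) ⊗ₘ f) ≫ (λ_ t).hom = (λ_ s).hom ≫ f := by
  simp

theorem tensorHom_comp_of_comp {a l l' k m m' n n' p : C} {e : l ⟶ a ⊗ l'} {f : l' ⟶ k}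
    {g : m ⟶ m'} {A : k ⊗ m' ⟶ n'} {A' : l' ⊗ m ⟶ n} {h : n ⟶ n'} {B : l ⊗ m ⟶ p}
    {e' : p ⟶ a ⊗ n} (E : (f ⊗ₘ g) ≫ A = A' ≫ h)
    (E' : e ▷ m ≫ (α_ a l' m).hom ≫ a ◁ A' = B ≫ e') :
    ((e ≫ a ◁ f) ⊗ₘ g) ≫ (α_ a k m').hom ≫ a ◁ A = B ≫ e' ≫ a ◁ h := by
  rw [← reassoc_of% E', ← MonoidalCategory.whiskerLeft_comp, ← E]
  simp [MonoidalCategory.tensorHom_def]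

theorem rightUnitor_tensor_of_comp {a t t' : C} {p : t ⊗ 𝟙_ C ⟶ t'} {h : t' ⟶ t}
    (e : (ρ_ t).hom = p ≫ h) :
    (ρ_ (a ⊗ t)).hom = ((α_ a t (𝟙_ C)).hom ≫ a ◁ p) ≫ a ◁ h := by
  rw [Category.assoc, ← MonoidalCategory.whiskerLeft_comp, ← e]
  simp

theorem tensor_inverse_of_inverse {a b c d : C} {f : a ⟶ b} {f' : b ⟶ a} {g : c ⟶ d} {g' : d ⟶ c}
    (hf : f ≫ f' = 𝟙 a) (hg : g ≫ g' = 𝟙 c) : (f ⊗ₘ g) ≫ (f' ⊗ₘ g') = 𝟙 (a ⊗ c) := by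
  rw [tensorHom_comp_tensorHom, hf, hg, id_tensorHom_id]

theorem tensor_comp_of_comp {a b a' b' s t s' t' m n : C} {f : a ⟶ b} {g : s ⟶ t} {p : a ⟶ a'}
    {q : b ⟶ b'} {r : s ⟶ s'} {w : t ⟶ t'} {h : a' ⟶ b'} {h' : s' ⟶ t'} {A : a' ⊗ s' ⟶ m}
    {B : b' ⊗ t' ⟶ n} {k : m ⟶ n} (E : f ≫ q = p ≫ h) (E' : g ≫ w = r ≫ h')
    (E'' : (h ⊗ₘ h') ≫ B = A ≫ k) :
    (f ⊗ₘ g) ≫ (q ⊗ₘ w) ≫ B = ((p ⊗ₘ r) ≫ A) ≫ k := by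
  rw [Category.assoc, ← E'', tensorHom_comp_tensorHom_assoc, tensorHom_comp_tensorHom_assoc, E, E']

theorem associator_comp_of_comp {s t w s' t' w' a b c d : C} {f : s ⟶ s'} {g : t ⟶ t'}
    {k : w ⟶ w'} {A : t' ⊗ w' ⟶ a} {B : s' ⊗ a ⟶ b} {A' : s' ⊗ t' ⟶ c} {B' : c ⊗ w' ⟶ d}
    {h : d ⟶ b} (E : (α_ s' t' w').hom ≫ s' ◁ A ≫ B = A' ▷ w' ≫ B' ≫ h) :
    (α_ s t w).hom ≫ (f ⊗ₘ ((g ⊗ₘ k) ≫ A)) ≫ B = ((((f ⊗ₘ g) ≫ A') ⊗ₘ k) ≫ B') ≫ h := by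
  have h₁ : (f ⊗ₘ ((g ⊗ₘ k) ≫ A)) = (f ⊗ₘ (g ⊗ₘ k)) ≫ s' ◁ A := by
    rw [← id_tensorHom, tensorHom_comp_tensorHom, Category.comp_id]
  have h₂ : (((f ⊗ₘ g) ≫ A') ⊗ₘ k) = ((f ⊗ₘ g) ⊗ₘ k) ≫ A' ▷ w' := by
    rw [← tensorHom_id, tensorHom_comp_tensorHom, Category.comp_id]
  rw [h₁, h₂, Category.assoc, Category.assoc, Category.assoc, ← E, associator_naturality_assoc]

theorem rightUnitor_comp_of_comp {s s' a : C} {f : s ⟶ s'} {A : s' ⊗ 𝟙_ C ⟶ a} {h : a ⟶ s'}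
    (E : (ρ_ s').hom = A ≫ h) : (ρ_ s).hom ≫ f = ((f ⊗ₘ 𝟙 (𝟙_ C)) ≫ A) ≫ h := by
  rw [Category.assoc, ← E]
  simp

end TensorLemmas

/-! ### Exchange of adjacent factors -/

section LeftSwap

variable {C : Type u} [Category.{v} C] [MonoidalCategory C] [SymmetricCategory C]

/-- Exchange of the first two factors of `a ⊗ (b ⊗ t)`. -/
def leftSwap (a b t : C) : a ⊗ (b ⊗ t) ⟶ b ⊗ (a ⊗ t) :=
  (α_ a b t).inv ≫ (β_ a b).hom ▷ t ≫ (α_ b a t).hom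

theorem leftSwap_natural (a b : C) {t t' : C} (f : t ⟶ t') :
    a ◁ b ◁ f ≫ leftSwap a b t' = leftSwap a b t ≫ b ◁ a ◁ f := by
  simp only [leftSwap, Category.assoc]
  rw [associator_inv_naturality_right_assoc, whisker_exchange_assoc,
    associator_naturality_right]

theorem leftSwap_leftSwap (a b t : C) : leftSwap a b t ≫ leftSwap b a t = 𝟙 _ := by
  simp only [leftSwap, Category.assoc, Iso.hom_inv_id_assoc, ← comp_whiskerRight_assoc,
    SymmetricCategory.symmetry, id_whiskerRight, Category.id_comp, Iso.inv_hom_id]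

/-- The Yang–Baxter equation of the braiding, tensored with the inert factor `t`; the rest is
rebracketing. -/
theorem leftSwap_yang_baxter (a b c t : C) :
    leftSwap a b (c ⊗ t) ≫ b ◁ leftSwap a c t ≫ leftSwap b c (a ⊗ t) =
      a ◁ leftSwap b c t ≫ leftSwap a c (b ⊗ t) ≫ c ◁ leftSwap a b t := by
  have h := congrArg (fun f => (α_ a b (c ⊗ t)).inv ≫ (α_ (a ⊗ b) c t).inv ≫
    (α_ a b c).hom ▷ t ≫ f ▷ t ≫ (α_ c (b ⊗ a) t).hom ≫ c ◁ (α_ b a t).hom)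
    (BraidedCategory.yang_baxter a b c)
  simp only [leftSwap]
  simp only [MonoidalCategory.whiskerLeft_comp, comp_whiskerRight, Category.assoc] at h ⊢
  convert h using 1 <;> monoidal

theorem braiding_unit_left_eq (a s : C) :
    (λ_ (a ⊗ s)).hom ≫ 𝟙 (a ⊗ s) =
      (α_ (𝟙_ C) a s).inv ≫ (β_ (𝟙_ C) a).hom ▷ s ≫ (α_ a (𝟙_ C) s).hom ≫ a ◁ (λ_ s).hom := by
  simp

/-- Hexagon: moving `b` in front of `a ⊗ t` means moving it past `t`, then past `a`. This is the
inductive step of `appendHom_extract_middle`. -/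
theorem leftSwap_braiding_of_comp {a b t s r w : C} {p : t ⊗ (b ⊗ s) ⟶ r} {e : r ⟶ b ⊗ w}
    {q : t ⊗ s ⟶ w}
    (E : p ≫ e = (α_ t b s).inv ≫ (β_ t b).hom ▷ s ≫ (α_ b t s).hom ≫ b ◁ q) :
    ((α_ a t (b ⊗ s)).hom ≫ a ◁ p) ≫ a ◁ e ≫ leftSwap a b w =
      (α_ (a ⊗ t) b s).inv ≫ (β_ (a ⊗ t) b).hom ▷ s ≫ (α_ b (a ⊗ t) s).hom ≫
        b ◁ ((α_ a t s).hom ≫ a ◁ q) := by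
  rw [Category.assoc, ← whiskerLeft_comp_assoc, E]
  simp only [MonoidalCategory.whiskerLeft_comp, Category.assoc, leftSwap_natural]
  simp only [BraidedCategory.braiding_tensor_left_hom, comp_whiskerRight, Category.assoc,
    leftSwap, whisker_assoc]
  monoidal

theorem braiding_unit_comp_of_comp {m m' : C} {p : m ⊗ 𝟙_ C ⟶ m'} {h : m' ⟶ m} {g : m ⟶ m'}
    (e : (ρ_ m).hom = p ≫ h) (E : h ≫ g = 𝟙 m') :
    (β_ (𝟙_ C) m).hom ≫ p = (λ_ m).hom ≫ g := by
  have : p = (ρ_ m).hom ≫ g := by rw [e, Category.assoc, E, Category.comp_id]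
  rw [this]
  simp

/-- The hexagon splits the braiding of `a ⊗ t` with `s`. The part that moves `a` cancels against the
braiding contained in `e`, because the category is symmetric. This is the inductive step of
`appendHom_braid`. -/
theorem braiding_tensor_comp_of_comp {a t s r w w' : C} {q : s ⊗ t ⟶ w} {p : t ⊗ s ⟶ w'}
    {h : w' ⟶ w} {M : s ⊗ (a ⊗ t) ⟶ r} {e : r ⟶ a ⊗ w} {g : a ⊗ w ⟶ r}
    (E : (β_ t s).hom ≫ q = p ≫ h)
    (E' : M ≫ e = (α_ s a t).inv ≫ (β_ s a).hom ▷ t ≫ (α_ a s t).hom ≫ a ◁ q)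
    (E'' : e ≫ g = 𝟙 r) :
    (β_ (a ⊗ t) s).hom ≫ M = ((α_ a t s).hom ≫ a ◁ p) ≫ a ◁ h ≫ g := by
  have : M = (α_ s a t).inv ≫ (β_ s a).hom ▷ t ≫ (α_ a s t).hom ≫ a ◁ q ≫ g := by
    rw [← Category.comp_id M, ← E'', reassoc_of% E']
  rw [this, Category.assoc, ← whiskerLeft_comp_assoc, ← E]
  simp only [BraidedCategory.braiding_tensor_left_hom, Category.assoc, Iso.hom_inv_id_assoc,
    ← comp_whiskerRight_assoc, SymmetricCategory.symmetry, id_whiskerRight, Category.id_comp,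
    Iso.inv_hom_id_assoc, MonoidalCategory.whiskerLeft_comp]

theorem braiding_comp_of_comp {s t s' t' a b : C} {f : s ⟶ s'} {g : t ⟶ t'} {A : t' ⊗ s' ⟶ a}
    {B : s' ⊗ t' ⟶ b} {h : b ⟶ a} (E : (β_ s' t').hom ≫ A = B ≫ h) :
    (β_ s t).hom ≫ (g ⊗ₘ f) ≫ A = ((f ⊗ₘ g) ≫ B) ≫ h := by
  rw [Category.assoc, ← E, BraidedCategory.braiding_naturality_assoc]

end LeftSwap

/-! ### Sorting symmetries of lists of letters -/

section Sorting

variable {ι : Type} {C : Type u} [Category.{v} C] [MonoidalCategory C] [SymmetricCategory C]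
  (x : ι → C)

/-- The right-bracketed tensor product of the objects labelled by a list of letters. -/
abbrev tensorList (l : List ι) : C := (Coh.ofList l).eval x

/-- `IsExtract x i l l' f` says that `l'` is `l` with an occurrence of `i` removed and that `f` is
the symmetry which moves the corresponding factor to the front. -/
inductive IsExtract (i : ι) : (l l' : List ι) → (tensorList x l ⟶ x i ⊗ tensorList x l') → Prop
  | head (l : List ι) : IsExtract i (i :: l) l (𝟙 (x i ⊗ tensorList x l))
  | tail (j : ι) {l l' : List ι} {f : tensorList x l ⟶ x i ⊗ tensorList x l'} :
      IsExtract i l l' f →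
        IsExtract i (j :: l) (j :: l') (x j ◁ f ≫ leftSwap (x j) (x i) (tensorList x l'))

/-- `IsSort x l m f` says that `f` is the composite of symmetries which arranges the factors of
`tensorList x l` in the order given by `m`, one letter at a time. -/
inductive IsSort : (l m : List ι) → (tensorList x l ⟶ tensorList x m) → Prop
  | nil : IsSort [] [] (𝟙 (𝟙_ C))
  | cons {i : ι} {l l' m : List ι} {e : tensorList x l ⟶ x i ⊗ tensorList x l'}
      {f : tensorList x l' ⟶ tensorList x m} :
      IsExtract x i l l' e → IsSort l' m f → IsSort l (i :: m) (e ≫ x i ◁ f)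

variable {x}

theorem IsExtract.perm {i : ι} {l l' : List ι} {f} (h : IsExtract x i l l' f) :
    l.Perm (i :: l') := by
  induction h with
  | head l => exact List.Perm.refl _
  | tail j _ ih => exact (ih.cons j).trans (List.Perm.swap _ _ _)

/-- If no letter repeats, `i` has only one position in the list, so the constructors `head` and
`tail` exclude each other. -/
theorem IsExtract.unique {i : ι} {l l' : List ι} {f} (h : IsExtract x i l l' f) :
    ∀ {l''} {g}, IsExtract x i l l'' g → l.Nodup → l' = l'' ∧ f ≍ g := by
  induction h with
  | head l =>
    intro l'' g hg hl
    cases hg with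
    | head => exact ⟨rfl, HEq.rfl⟩
    | tail _ h => exact absurd (h.perm.mem_iff.2 List.mem_cons_self) (List.nodup_cons.1 hl).1
  | tail j h ih =>
    intro l'' g hg hl
    cases hg with
    | head => exact absurd (h.perm.mem_iff.2 List.mem_cons_self) (List.nodup_cons.1 hl).1
    | tail _ h' =>
      obtain ⟨rfl, hf⟩ := ih h' (List.nodup_cons.1 hl).2
      obtain rfl := eq_of_heq hf
      exact ⟨rfl, HEq.rfl⟩

/-- The head of the target says which letter is extracted next, and the extraction is unique. -/
theorem IsSort.unique {l m : List ι} {f} (h : IsSort x l m f) :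
    ∀ {g}, IsSort x l m g → l.Nodup → f = g := by
  induction h with
  | nil => intro g hg _; cases hg; rfl
  | cons he _ ih =>
    intro g hg hl
    cases hg with
    | cons he' hf' =>
      obtain ⟨rfl, h⟩ := he.unique he' hl
      obtain rfl := eq_of_heq h
      rw [ih hf' (List.nodup_cons.1 (he.perm.nodup_iff.1 hl)).2]

/-- Extracting two letters in either order gives the same symmetry up to an exchange of the two. If
one of them heads the list, this is the definition of extraction or the involutivity of `leftSwap`;
if a third letter heads it, this is Yang–Baxter. -/
theorem IsExtract.exchange {i : ι} {l l₁ : List ι} {f} (hf : IsExtract x i l l₁ f) :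
    ∀ {j : ι} {l₂ : List ι} {g}, IsExtract x j l₁ l₂ g →
      ∃ l₁' f' g', IsExtract x j l l₁' f' ∧ IsExtract x i l₁' l₂ g' ∧
        f ≫ x i ◁ g ≫ leftSwap (x i) (x j) (tensorList x l₂) = f' ≫ x j ◁ g' := by
  induction hf with
  | head l =>
    intro j l₂ g hg
    refine ⟨_, _, _, hg.tail i, .head l₂, ?_⟩
    dsimp only [tensorList, Coh.ofList, Word.eval, List.cons_append, List.nil_append]
    simp
  | @tail k l₀ l₀' f₀ h ih =>
    intro j l₂ g hg
    cases hg with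
    | head =>
      refine ⟨_, _, _, .head l₀, h, ?_⟩
      dsimp only [tensorList, Coh.ofList, Word.eval, List.cons_append, List.nil_append]
      simp [leftSwap_leftSwap]
    | @tail _ _ l₂' g₀ hg =>
      obtain ⟨l₁', f', g', hf', hg', e⟩ := ih hg
      refine ⟨_, _, _, hf'.tail k, hg'.tail k, ?_⟩
      dsimp only [tensorList, Coh.ofList, Word.eval, List.cons_append, List.nil_append]
      simp only [Category.assoc, MonoidalCategory.whiskerLeft_comp]
      rw [← reassoc_of% leftSwap_natural, leftSwap_yang_baxter, ← reassoc_of% leftSwap_natural]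
      simp only [← whiskerLeft_comp_assoc, e]

/-- The core of closure under composition: an extraction after a sort can be performed before it. It
passes each letter already placed by `IsExtract.exchange`. -/
theorem IsSort.comp_extract {l m : List ι} {f} (hf : IsSort x l m f) :
    ∀ {i : ι} {m' : List ι} {g}, IsExtract x i m m' g →
      ∃ l' g' f', IsExtract x i l l' g' ∧ IsSort x l' m' f' ∧ f ≫ g = g' ≫ x i ◁ f' := by
  induction hf with
  | nil => intro i m' g hg; cases hg
  | @cons j l l₀ m e f he hf ih =>
    intro i m' g hg
    cases hg with
    | head => exact ⟨_, _, _, he, hf, Category.comp_id _⟩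
    | @tail _ _ m₀ g₀ hg =>
      obtain ⟨l', g', f', hg', hf', h⟩ := ih hg
      obtain ⟨l₁, e', e'', he', he'', h'⟩ := he.exchange hg'
      refine ⟨_, _, _, he', IsSort.cons he'' hf', ?_⟩
      dsimp only [tensorList, Coh.ofList, Word.eval, List.cons_append, List.nil_append]
      rw [MonoidalCategory.whiskerLeft_comp, ← reassoc_of% h', ← leftSwap_natural]
      simp only [Category.assoc, ← whiskerLeft_comp_assoc, h]

theorem IsSort.congr {l m : List ι} {f g} (h : IsSort x l m f) (e : f = g) : IsSort x l m g :=
  e ▸ h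

theorem IsSort.trans {m k : List ι} {g} (hg : IsSort x m k g) :
    ∀ {l : List ι} {f}, IsSort x l m f → IsSort x l k (f ≫ g) := by
  induction hg with
  | nil => intro l f hf; exact hf.congr (Category.comp_id f).symm
  | @cons i m m' k e g he _ ih =>
    intro l f hf
    obtain ⟨l', e', f', he', hf', h⟩ := hf.comp_extract he
    refine (IsSort.cons he' (ih hf')).congr ?_
    dsimp only [tensorList, Coh.ofList, Word.eval, List.cons_append, List.nil_append] at *
    rw [MonoidalCategory.whiskerLeft_comp, ← reassoc_of% h]

theorem IsSort.cons_cons (i : ι) {l m : List ι} {f} (h : IsSort x l m f) :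
    IsSort x (i :: l) (i :: m) (x i ◁ f) :=
  (IsSort.cons (.head l) h).congr (Category.id_comp (x i ◁ f))

theorem IsSort.refl : ∀ l : List ι, IsSort x l l (𝟙 (tensorList x l))
  | [] => .nil
  | i :: l => ((IsSort.refl l).cons_cons i).congr (MonoidalCategory.whiskerLeft_id _ _)

theorem IsExtract.isSort {i : ι} {l l' : List ι} {f} (h : IsExtract x i l l' f) :
    IsSort x l (i :: l') f :=
  (IsSort.cons h (.refl l')).congr
    ((congrArg (f ≫ ·) (MonoidalCategory.whiskerLeft_id _ _)).trans (Category.comp_id f))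

theorem IsSort.swap (i j : ι) (l : List ι) :
    IsSort x (i :: j :: l) (j :: i :: l) (leftSwap (x i) (x j) (tensorList x l)) :=
  ((IsExtract.head (x := x) (i := j) l).tail i).isSort.congr
    ((congrArg (· ≫ leftSwap (x i) (x j) (tensorList x l))
      (MonoidalCategory.whiskerLeft_id _ _)).trans (Category.id_comp _))

/-- Putting a letter back need not be an extraction, but it is a chain of exchanges, hence a sort.
-/
theorem IsExtract.symm {i : ι} {l l' : List ι} {f} (h : IsExtract x i l l' f) :
    ∃ g : x i ⊗ tensorList x l' ⟶ tensorList x l, IsSort x (i :: l') l g ∧ f ≫ g = 𝟙 _ := by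
  induction h with
  | head l => exact ⟨𝟙 _, .refl _, Category.id_comp _⟩
  | @tail j l l' f _ ih =>
    obtain ⟨g, hg, e⟩ := ih
    refine ⟨_, (hg.cons_cons j).trans (.swap i j l'), ?_⟩
    dsimp only [tensorList, Coh.ofList, Word.eval, List.cons_append, List.nil_append] at *
    rw [Category.assoc, reassoc_of% leftSwap_leftSwap, ← MonoidalCategory.whiskerLeft_comp, e]
    exact MonoidalCategory.whiskerLeft_id _ _

theorem IsSort.symm {l m : List ι} {f} (h : IsSort x l m f) :
    ∃ g, IsSort x m l g ∧ f ≫ g = 𝟙 _ := by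
  induction h with
  | nil => exact ⟨_, .nil, Category.id_comp _⟩
  | @cons i l l' m e f he _ ih =>
    obtain ⟨g, hg, h⟩ := ih
    obtain ⟨d, hd, h'⟩ := he.symm
    refine ⟨_, hd.trans (hg.cons_cons i), ?_⟩
    dsimp only [tensorList, Coh.ofList, Word.eval, List.cons_append, List.nil_append] at *
    rw [Category.assoc, ← whiskerLeft_comp_assoc, h, MonoidalCategory.whiskerLeft_id,
      Category.id_comp, h']

/-! ### Juxtaposition of lists -/

/-- The canonical isomorphism from the tensor product of two lists to their juxtaposition. -/
abbrev appendHom (x : ι → C) (l m : List ι) :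
    tensorList x l ⊗ tensorList x m ⟶ tensorList x (l ++ m) :=
  (Coh.append l m).eval x

theorem appendHom_nil (m : List ι) : appendHom x [] m = (λ_ (tensorList x m)).hom := rfl

theorem appendHom_cons (i : ι) (l m : List ι) :
    appendHom x (i :: l) m =
      (α_ (x i) (tensorList x l) (tensorList x m)).hom ≫ x i ◁ appendHom x l m := by
  rw [← id_tensorHom]; rfl

theorem IsExtract.append {i : ι} {l l' : List ι} {f} (h : IsExtract x i l l' f) (m : List ι) :
    ∃ g, IsExtract x i (l ++ m) (l' ++ m) g ∧
      f ▷ tensorList x m ≫ (α_ _ _ _).hom ≫ x i ◁ appendHom x l' m = appendHom x l m ≫ g := by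
  induction h with
  | head l => exact ⟨_, .head _, by
    dsimp only [tensorList, Coh.ofList, Word.eval, List.cons_append, List.nil_append] at *
    simp [appendHom_cons]⟩
  | @tail j l l' f _ ih =>
    obtain ⟨g, hg, e⟩ := ih
    refine ⟨_, hg.tail j, ?_⟩
    dsimp only [tensorList, Coh.ofList, Word.eval, List.cons_append, List.nil_append] at *
    rw [appendHom_cons, appendHom_cons, Category.assoc, ← whiskerLeft_comp_assoc, ← e]
    simp only [MonoidalCategory.whiskerLeft_comp, Category.assoc]
    rw [leftSwap_natural]
    simp only [comp_whiskerRight, Category.assoc, leftSwap]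
    simp only [whisker_assoc, Category.assoc]
    monoidal

/-- Letters of the left factor are extracted first; when it is exhausted, the remaining sort is the
one given for the right factor. -/
theorem IsSort.append {l l' m m' : List ι} {f g} (hf : IsSort x l l' f) (hg : IsSort x m m' g) :
    ∃ h, IsSort x (l ++ m) (l' ++ m') h ∧
      (f ⊗ₘ g) ≫ appendHom x l' m' = appendHom x l m ≫ h := by
  induction hf with
  | nil =>
    refine ⟨g, hg, ?_⟩
    rw [appendHom_nil, appendHom_nil]
    exact leftUnitor_naturality' g
  | @cons i l l' k e f he _ ih =>
    obtain ⟨h, hh, E⟩ := ih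
    obtain ⟨e', he', E'⟩ := he.append m
    refine ⟨_, IsSort.cons he' hh, ?_⟩
    rw [appendHom_cons]
    exact tensorHom_comp_of_comp E E'

/-- The lists `(l ++ m) ++ k` and `l ++ (m ++ k)` are equal but not by definition. A sort between
them takes the place of a transport. -/
theorem appendHom_assoc (l m k : List ι) :
    ∃ h, IsSort x ((l ++ m) ++ k) (l ++ (m ++ k)) h ∧
      (α_ _ _ _).hom ≫ tensorList x l ◁ appendHom x m k ≫ appendHom x l (m ++ k) =
        appendHom x l m ▷ tensorList x k ≫ appendHom x (l ++ m) k ≫ h := by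
  induction l with
  | nil => exact ⟨𝟙 _, .refl _, by
    dsimp only [tensorList, Coh.ofList, Word.eval, List.cons_append, List.nil_append] at *
    simp [appendHom_nil]⟩
  | cons i l ih =>
    obtain ⟨h, hh, e⟩ := ih
    refine ⟨_, hh.cons_cons i, ?_⟩
    dsimp only [tensorList, Coh.ofList, Word.eval, List.cons_append, List.nil_append] at *
    simp only [appendHom_cons, comp_whiskerRight, Category.assoc]
    simp only [whisker_assoc, Category.assoc, Iso.inv_hom_id_assoc,
      ← MonoidalCategory.whiskerLeft_comp]
    rw [← e]
    simp

theorem appendHom_nil_right (l : List ι) :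
    ∃ h, IsSort x (l ++ []) l h ∧ (ρ_ (tensorList x l)).hom = appendHom x l [] ≫ h := by
  induction l with
  | nil => exact ⟨𝟙 _, .refl _, unitors_equal.symm.trans (Category.comp_id (λ_ (𝟙_ C)).hom).symm⟩
  | cons i l ih =>
    obtain ⟨h, hh, e⟩ := ih
    refine ⟨_, hh.cons_cons i, ?_⟩
    rw [appendHom_cons]
    exact rightUnitor_tensor_of_comp e

/-- Extracting `i` from behind the block `m`, one exchange at a time, amounts to a single braiding
of the whole block with `i`. -/
theorem appendHom_extract_middle (m : List ι) (i : ι) (l : List ι) :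
    ∃ e, IsExtract x i (m ++ i :: l) (m ++ l) e ∧
      appendHom x m (i :: l) ≫ e =
        (α_ _ _ _).inv ≫ (β_ (tensorList x m) (x i)).hom ▷ tensorList x l ≫ (α_ _ _ _).hom ≫
          x i ◁ appendHom x m l := by
  induction m with
  | nil =>
    refine ⟨_, .head _, ?_⟩
    rw [appendHom_nil, appendHom_nil]
    exact braiding_unit_left_eq _ _
  | cons j m ih =>
    obtain ⟨e, he, E⟩ := ih
    refine ⟨_, he.tail j, ?_⟩
    rw [appendHom_cons, appendHom_cons]
    exact leftSwap_braiding_of_comp E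

theorem appendHom_braid (l m : List ι) :
    ∃ h, IsSort x (l ++ m) (m ++ l) h ∧
      (β_ _ _).hom ≫ appendHom x m l = appendHom x l m ≫ h := by
  induction l with
  | nil =>
    obtain ⟨h, hh, e⟩ := appendHom_nil_right (x := x) m
    obtain ⟨g, hg, E⟩ := hh.symm
    refine ⟨g, hg, ?_⟩
    rw [appendHom_nil]
    exact braiding_unit_comp_of_comp e E
  | cons i l ih =>
    obtain ⟨h, hh, E⟩ := ih
    obtain ⟨e, he, E'⟩ := appendHom_extract_middle (x := x) m i l
    obtain ⟨g, hg, E''⟩ := he.symm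
    refine ⟨_, hg.trans (hh.cons_cons i), ?_⟩
    rw [appendHom_cons]
    exact braiding_tensor_comp_of_comp E E' E''

/-! ### Normalization of formal composites -/

/-- The canonical isomorphism from the value of a word to the tensor product of its letters. -/
abbrev normalizeHom (x : ι → C) (t : Word ι) : t.eval x ⟶ tensorList x t.letters :=
  (Coh.normalize t).eval x

theorem normalizeHom_mul (s t : Word ι) :
    normalizeHom x (.mul s t) =
      (normalizeHom x s ⊗ₘ normalizeHom x t) ≫ appendHom x s.letters t.letters := rfl

theorem Coh.eval_comp_eval_symm {s t : Word ι} (c : Coh s t) :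
    c.eval x ≫ c.symm.eval x = 𝟙 (s.eval x) := by
  induction c with
  | ident s => exact Category.comp_id _
  | comp f g hf hg => exact comp_inverse_of_inverse hf hg
  | tensor f g hf hg => exact tensor_inverse_of_inverse hf hg
  | assoc s t w => exact Iso.hom_inv_id _
  | assocInv s t w => exact Iso.inv_hom_id _
  | leftUnit s => exact Iso.hom_inv_id _
  | leftUnitInv s => exact Iso.inv_hom_id _
  | rightUnit s => exact Iso.hom_inv_id _
  | rightUnitInv s => exact Iso.inv_hom_id _
  | braid s t => exact SymmetricCategory.symmetry _ _

theorem Coh.eval_symm_comp_eval {s t : Word ι} (c : Coh s t) :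
    c.symm.eval x ≫ c.eval x = 𝟙 (t.eval x) := by
  induction c with
  | ident s => exact Category.comp_id _
  | comp f g hf hg => exact comp_inverse_of_inverse hg hf
  | tensor f g hf hg => exact tensor_inverse_of_inverse hf hg
  | assoc s t w => exact Iso.inv_hom_id _
  | assocInv s t w => exact Iso.hom_inv_id _
  | leftUnit s => exact Iso.inv_hom_id _
  | leftUnitInv s => exact Iso.hom_inv_id _
  | rightUnit s => exact Iso.inv_hom_id _
  | rightUnitInv s => exact Iso.hom_inv_id _
  | braid s t => exact SymmetricCategory.symmetry _ _

/-- The value of a formal composite is an isomorphism. -/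
def Coh.evalIso (x : ι → C) {s t : Word ι} (c : Coh s t) : s.eval x ≅ t.eval x where
  hom := c.eval x
  inv := c.symm.eval x
  hom_inv_id := c.eval_comp_eval_symm
  inv_hom_id := c.eval_symm_comp_eval

variable (x) in
/-- Up to normalization, the value of a formal composite is the symmetry that sorts the letters. -/
def Coh.IsSorted {s t : Word ι} (f : s.eval x ⟶ t.eval x) : Prop :=
  ∃ h, IsSort x s.letters t.letters h ∧ f ≫ normalizeHom x t = normalizeHom x s ≫ h

theorem Coh.IsSorted.inv {s t : Word ι} {e : s.eval x ≅ t.eval x} (h : Coh.IsSorted x e.hom) :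
    Coh.IsSorted x e.inv := by
  obtain ⟨h, hh, E⟩ := h
  obtain ⟨g, hg, E'⟩ := hh.symm
  exact ⟨g, hg, by rw [Iso.inv_comp_eq, reassoc_of% E, E', Category.comp_id]⟩

theorem Coh.isSorted_associator (s t w : Word ι) :
    Coh.IsSorted x (s := .mul (.mul s t) w) (t := .mul s (.mul t w))
      (α_ (s.eval x) (t.eval x) (w.eval x)).hom := by
  obtain ⟨h, hh, E⟩ := appendHom_assoc (x := x) s.letters t.letters w.letters
  refine ⟨h, hh, ?_⟩
  rw [normalizeHom_mul, normalizeHom_mul, normalizeHom_mul, normalizeHom_mul]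
  exact associator_comp_of_comp E

theorem Coh.isSorted_leftUnitor (s : Word ι) :
    Coh.IsSorted x (s := .mul .unit s) (t := s) (λ_ (s.eval x)).hom :=
  ⟨𝟙 _, .refl _, (leftUnitor_naturality' (normalizeHom x s)).symm.trans (Category.comp_id _).symm⟩

theorem Coh.isSorted_rightUnitor (s : Word ι) :
    Coh.IsSorted x (s := .mul s .unit) (t := s) (ρ_ (s.eval x)).hom := by
  obtain ⟨h, hh, E⟩ := appendHom_nil_right (x := x) s.letters
  exact ⟨h, hh, rightUnitor_comp_of_comp E⟩

/-- Induction over formal composites: the lemmas on `appendHom` treat the generators, and closure of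
sorts under composition, inversion and juxtaposition does the rest. Repeated letters are harmless
here; they matter only for uniqueness. -/
theorem Coh.isSorted_eval {s t : Word ι} (c : Coh s t) : Coh.IsSorted x (c.eval x) := by
  induction c with
  | ident s => exact ⟨𝟙 _, .refl _, (Category.id_comp _).trans (Category.comp_id _).symm⟩
  | comp f g hf hg =>
    obtain ⟨h, hh, E⟩ := hf
    obtain ⟨h', hh', E'⟩ := hg
    exact ⟨_, hh'.trans hh, comp_comp_of_comp E E'⟩
  | tensor f g hf hg =>
    obtain ⟨h, hh, E⟩ := hf
    obtain ⟨h', hh', E'⟩ := hg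
    obtain ⟨k, hk, E''⟩ := hh.append hh'
    exact ⟨k, hk, tensor_comp_of_comp E E' E''⟩
  | assoc s t w => exact Coh.isSorted_associator s t w
  | assocInv s t w =>
    exact Coh.IsSorted.inv (s := .mul (.mul s t) w) (t := .mul s (.mul t w))
      (e := α_ (s.eval x) (t.eval x) (w.eval x)) (Coh.isSorted_associator s t w)
  | leftUnit s => exact Coh.isSorted_leftUnitor s
  | leftUnitInv s =>
    exact Coh.IsSorted.inv (s := .mul .unit s) (t := s) (e := λ_ (s.eval x))
      (Coh.isSorted_leftUnitor s)
  | rightUnit s => exact Coh.isSorted_rightUnitor s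
  | rightUnitInv s =>
    exact Coh.IsSorted.inv (s := .mul s .unit) (t := s) (e := ρ_ (s.eval x))
      (Coh.isSorted_rightUnitor s)
  | braid s t =>
    obtain ⟨h, hh, E⟩ := appendHom_braid (x := x) s.letters t.letters
    exact ⟨h, hh, braiding_comp_of_comp E⟩

/-- Coherence: a formal composite between words without repeated letters is determined by its
source and target. -/
theorem Coh.eval_eq {s t : Word ι} (hs : s.letters.Nodup) (c d : Coh s t) :
    c.eval x = d.eval x := by
  obtain ⟨h, hh, E⟩ := c.isSorted_eval (x := x)
  obtain ⟨h', hh', E'⟩ := d.isSorted_eval (x := x)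
  -- Both normalized maps are sorts between the same two lists, so they coincide; the normalization
  -- of `t` is then cancelled as an isomorphism.
  obtain rfl := hh.unique hh' hs
  exact (cancel_mono ((Coh.normalize t).evalIso x).hom).1 (E.trans E'.symm)

theorem Coh.letters_perm {s t : Word ι} (c : Coh s t) : s.letters.Perm t.letters := by
  induction c with
  | ident s => exact .refl _
  | comp f g hf hg => exact hf.trans hg
  | tensor f g hf hg => exact hf.append hg
  | assoc s t w => simp [Word.letters]
  | assocInv s t w => simp [Word.letters]
  | leftUnit s => simp [Word.letters]
  | leftUnitInv s => simp [Word.letters]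
  | rightUnit s => simp [Word.letters]
  | rightUnitInv s => simp [Word.letters]
  | braid s t => exact List.perm_append_comm

theorem Coh.nonempty_of_letters_perm {s t : Word ι} (h : s.letters.Perm t.letters) :
    Nonempty (Coh s t) :=
  (Coh.nonempty_of_perm h).map fun f => .comp (Coh.normalize s) (.comp f (Coh.normalize t).symm)

end Sorting

/-! ## Substitution of words -/

section TensorLemmas

variable {C : Type u} [Category.{v} C]

theorem comp_of_conj {a b c' d d' r p : C} {A : p ≅ c'} {S : c' ≅ a} {R : d ≅ a}
    {R' : p ≅ d} {T : d' ≅ b} {k : p ⟶ d'} {f : d ⟶ b} {g : d' ⟶ r}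
    (h : R'.hom ≫ R.hom = A.hom ≫ S.hom ≫ 𝟙 a) (h' : k ≫ T.hom = R'.hom ≫ f) :
    (R.inv ≫ f) ≫ T.inv ≫ g = S.inv ≫ A.inv ≫ k ≫ g := by
  have e : f = R'.inv ≫ k ≫ T.hom := by rw [h', Iso.inv_hom_id_assoc]
  have e' : R.inv ≫ R'.inv = S.inv ≫ A.inv := by
    rw [Category.comp_id] at h
    rw [← Iso.trans_hom, ← Iso.trans_hom] at h
    have := congrArg Iso.inv (Iso.ext h)
    simpa using this
  rw [e]
  simp only [Category.assoc, Iso.hom_inv_id_assoc]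
  rw [reassoc_of% e']

theorem rename_of_conj {a b c r p : C} {S : c ≅ a} {R : p ≅ b} {R' : b ⟶ a} {A : p ⟶ c} {f : c ⟶ r}
    (h : R.hom ≫ R' = A ≫ S.hom ≫ 𝟙 a) : R' ≫ S.inv ≫ f = R.inv ≫ A ≫ f := by
  rw [← cancel_epi R.hom, reassoc_of% h, Iso.hom_inv_id_assoc, Iso.hom_inv_id_assoc]

theorem conj_natural {a a' b b' c c' : C} {S : a ≅ b} {S' : a' ≅ b'} {p : a ⟶ a'} {q : b ⟶ b'}
    {f : a ⟶ c} {f' : a' ⟶ c'} {r : c ⟶ c'} (h : p ≫ S'.hom = S.hom ≫ q) (h' : f ≫ r = p ≫ f') :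
    q ≫ S'.inv ≫ f' = (S.inv ≫ f) ≫ r := by
  rw [Category.assoc, h', Iso.eq_inv_comp, ← reassoc_of% h, Iso.hom_inv_id_assoc]

theorem subst_of_conj {a b c d a' b' c' d' p q q' : C} {R : a ≅ b} {S : b ≅ c} {A : a ⟶ a'}
    {U : a' ⟶ d} {m : d ⟶ c} {n : c ⟶ d'} {R' : c' ≅ d'} {A' : p ≅ b'} {U' : b' ⟶ d'} {k : a' ⟶ b'}
    {V : p ⟶ c'} {g : c' ⟶ q} {V' : q' ≅ q} {g' : p ⟶ q'}
    (h₁ : A ≫ U ≫ m = R.hom ≫ S.hom) (h₂ : k ≫ U' = U ≫ m ≫ n)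
    (h₃ : V ≫ R'.hom = A'.hom ≫ U' ≫ 𝟙 d') (h₄ : g' ≫ V'.hom = V ≫ g) :
    S.hom ≫ n ≫ (R'.inv ≫ g) ≫ V'.inv = R.inv ≫ A ≫ k ≫ A'.inv ≫ g' := by
  have e₁ : S.hom = R.inv ≫ A ≫ U ≫ m := by rw [h₁, Iso.inv_hom_id_assoc]
  have e₃ : U' = A'.inv ≫ V ≫ R'.hom := by rw [h₃, Iso.inv_hom_id_assoc, Category.comp_id]
  rw [e₁]
  simp only [Category.assoc]
  rw [← reassoc_of% h₂, e₃]
  simp only [Category.assoc, Iso.hom_inv_id_assoc]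
  rw [← reassoc_of% h₄, Iso.hom_inv_id, Category.comp_id]

variable [MonoidalCategory C]

theorem leftUnitor_inv_naturality' {s t : C} (f : s ⟶ t) :
    (λ_ s).inv ≫ (𝟙 (𝟙_ C) ⊗ₘ f) = f ≫ (λ_ t).inv := by
  simp

theorem rightUnitor_naturality' {s t : C} (f : s ⟶ t) :
    (f ⊗ₘ 𝟙 (𝟙_ C)) ≫ (ρ_ t).hom = (ρ_ s).hom ≫ f := by
  simp

theorem rightUnitor_inv_naturality' {s t : C} (f : s ⟶ t) :
    (ρ_ s).inv ≫ (f ⊗ₘ 𝟙 (𝟙_ C)) = f ≫ (ρ_ t).inv := by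
  simp

theorem tensor_comp_comp_of_comp {a b c d e a' b' c' d' e' : C} {f : a ⟶ b} {g : b ⟶ c}
    {h : c ⟶ d} {k : a ⟶ e} {l : e ⟶ d} {f' : a' ⟶ b'} {g' : b' ⟶ c'} {h' : c' ⟶ d'} {k' : a' ⟶ e'}
    {l' : e' ⟶ d'} (E : f ≫ g ≫ h = k ≫ l) (E' : f' ≫ g' ≫ h' = k' ≫ l') :
    (f ⊗ₘ f') ≫ (g ⊗ₘ g') ≫ (h ⊗ₘ h') = (k ⊗ₘ k') ≫ (l ⊗ₘ l') := by
  simp only [tensorHom_comp_tensorHom, E, E']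

end TensorLemmas

section EvalMap

variable {ι : Type} {C : Type u} [Category.{v} C] [MonoidalCategory C]

theorem Word.evalMap_id (x : ι → C) (t : Word ι) : t.evalMap (fun i => 𝟙 (x i)) = 𝟙 (t.eval x) := by
  induction t with
  | unit => rfl
  | var i => rfl
  | mul s t hs ht => exact (congrArg₂ _ hs ht).trans (id_tensorHom_id _ _)

theorem Word.evalMap_comp {x y z : ι → C} (f : ∀ i, x i ⟶ y i) (g : ∀ i, y i ⟶ z i) (t : Word ι) :
    t.evalMap (fun i => f i ≫ g i) = t.evalMap f ≫ t.evalMap g := by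
  induction t with
  | unit => exact (Category.id_comp _).symm
  | var i => rfl
  | mul s t hs ht => exact (congrArg₂ _ hs ht).trans (tensorHom_comp_tensorHom _ _ _ _).symm

theorem Word.evalMap_eqToHom {x y : ι → C} (h : ∀ i, x i = y i) (t : Word ι) :
    t.evalMap (fun i => eqToHom (h i)) = eqToHom (congrArg t.eval (funext h)) := by
  obtain rfl : x = y := funext h
  exact t.evalMap_id x

end EvalMap

section SubstIso

variable {ι ι' ι'' : Type} {C : Type u} [Category.{v} C] [MonoidalCategory C]

/-- Evaluation of a substituted word. -/
def Word.substIso (x : ι' → C) (w : ι → Word ι') :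
    (t : Word ι) → ((t.subst w).eval x ≅ t.eval (fun i => (w i).eval x))
  | .unit => Iso.refl (𝟙_ C)
  | .var i => Iso.refl ((w i).eval x)
  | .mul s t => s.substIso x w ⊗ᵢ t.substIso x w

/-- Evaluation of a word with renamed letters. -/
def Word.renameIso (x : ι' → C) (e : ι → ι') (t : Word ι) : (t.rename e).eval x ≅ t.eval (x ∘ e) :=
  t.substIso x (fun i => .var (e i))

/-- The definition of `U` compares equal objects by `eqToHom`. This replaces it by a map defined by
recursion on words, to which naturality arguments apply. -/
theorem Word.substIso_hom_eq_eqToHom (x : ι' → C) (w : ι → Word ι') (t : Word ι) :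
    (t.substIso x w).hom = eqToHom (t.eval_subst x w) := by
  induction t with
  | unit => rfl
  | var i => rfl
  | mul s t hs ht =>
    refine (congrArg₂ _ hs ht).trans ?_
    have : ∀ {a b c d : C} (h : a = b) (h' : c = d),
        (eqToHom h ⊗ₘ eqToHom h') = eqToHom (congrArg₂ _ h h') := by
      rintro a _ c _ rfl rfl
      exact id_tensorHom_id a c
    exact this _ _

theorem Word.substIso_hom_natural {x y : ι' → C} (f : ∀ i, x i ⟶ y i) (w : ι → Word ι')
    (t : Word ι) :
    (t.subst w).evalMap f ≫ (t.substIso y w).hom =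
      (t.substIso x w).hom ≫ t.evalMap (fun i => (w i).evalMap f) := by
  induction t with
  | unit => rfl
  | var i => exact (Category.comp_id _).trans (Category.id_comp _).symm
  | mul s t hs ht =>
    exact (tensorHom_comp_tensorHom _ _ _ _).trans
      ((congrArg₂ _ hs ht).trans (tensorHom_comp_tensorHom _ _ _ _).symm)

variable [SymmetricCategory C]

/-- Substitution in a formal composite. -/
def Coh.subst (w : ι → Word ι') : {s t : Word ι} → Coh s t → Coh (s.subst w) (t.subst w)
  | _, _, ident s => ident _
  | _, _, comp f g => comp (f.subst w) (g.subst w)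
  | _, _, tensor f g => tensor (f.subst w) (g.subst w)
  | _, _, assoc s t r => assoc _ _ _
  | _, _, assocInv s t r => assocInv _ _ _
  | _, _, leftUnit s => leftUnit _
  | _, _, leftUnitInv s => leftUnitInv _
  | _, _, rightUnit s => rightUnit _
  | _, _, rightUnitInv s => rightUnitInv _
  | _, _, braid s t => braid _ _

/-- For each generator this is naturality of a structure isomorphism with respect to the maps
`substIso`. -/
theorem Coh.eval_subst (x : ι' → C) (w : ι → Word ι') {s t : Word ι} (c : Coh s t) :
    (c.subst w).eval x ≫ (t.substIso x w).hom =
      (s.substIso x w).hom ≫ c.eval (fun i => (w i).eval x) := by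
  induction c with
  | ident s => exact (Category.id_comp _).trans (Category.comp_id _).symm
  | comp f g hf hg => exact comp_comp_of_comp hf hg
  | tensor f g hf hg =>
    exact (tensorHom_comp_tensorHom _ _ _ _).trans
      ((congrArg₂ _ hf hg).trans (tensorHom_comp_tensorHom _ _ _ _).symm)
  | assoc s t w => exact (associator_naturality _ _ _).symm
  | assocInv s t w => exact (associator_inv_naturality _ _ _).symm
  | leftUnit s => exact (leftUnitor_naturality' _).symm
  | leftUnitInv s => exact leftUnitor_inv_naturality' (s.substIso x w).hom
  | rightUnit s => exact (rightUnitor_naturality' _).symm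
  | rightUnitInv s => exact rightUnitor_inv_naturality' (s.substIso x w).hom
  | braid s t => exact (BraidedCategory.braiding_naturality _ _).symm

theorem Coh.eval_natural {x y : ι → C} (f : ∀ i, x i ⟶ y i) {s t : Word ι} (c : Coh s t) :
    c.eval x ≫ t.evalMap f = s.evalMap f ≫ c.eval y := by
  induction c with
  | ident s => exact (Category.id_comp _).trans (Category.comp_id _).symm
  | comp f g hf hg => exact comp_comp_of_comp hf hg
  | tensor f g hf hg =>
    exact (tensorHom_comp_tensorHom _ _ _ _).trans
      ((congrArg₂ _ hf hg).trans (tensorHom_comp_tensorHom _ _ _ _).symm)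
  | assoc s t w => exact (associator_naturality _ _ _).symm
  | assocInv s t w => exact (associator_inv_naturality _ _ _).symm
  | leftUnit s => exact (leftUnitor_naturality' _).symm
  | leftUnitInv s => exact leftUnitor_inv_naturality' (s.evalMap f)
  | rightUnit s => exact (rightUnitor_naturality' _).symm
  | rightUnitInv s => exact rightUnitor_inv_naturality' (s.evalMap f)
  | braid s t => exact (BraidedCategory.braiding_naturality _ _).symm

/-- Formal composites can be substituted for the letters of a word. -/
def Coh.substMap {w w' : ι → Word ι'} (c : ∀ i, Coh (w i) (w' i)) :
    (t : Word ι) → Coh (t.subst w) (t.subst w')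
  | .unit => ident _
  | .var i => c i
  | .mul s t => tensor (substMap c s) (substMap c t)

theorem Coh.eval_substMap (x : ι' → C) {w w' : ι → Word ι'} (c : ∀ i, Coh (w i) (w' i))
    (t : Word ι) :
    (substMap c t).eval x ≫ (t.substIso x w').hom =
      (t.substIso x w).hom ≫ t.evalMap (fun i => (c i).eval x) := by
  induction t with
  | unit => rfl
  | var i => exact (Category.comp_id _).trans (Category.id_comp _).symm
  | mul s t hs ht =>
    exact (tensorHom_comp_tensorHom _ _ _ _).trans
      ((congrArg₂ _ hs ht).trans (tensorHom_comp_tensorHom _ _ _ _).symm)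

/-- Associativity of substitution. -/
def Coh.substAssoc (w : ι → Word ι') (r : ι' → Word ι'') :
    (t : Word ι) → Coh ((t.subst w).subst r) (t.subst fun i => (w i).subst r)
  | .unit => ident _
  | .var _ => ident _
  | .mul s t => tensor (substAssoc w r s) (substAssoc w r t)

theorem Coh.eval_substAssoc (x : ι'' → C) (w : ι → Word ι') (r : ι' → Word ι'') (t : Word ι) :
    (substAssoc w r t).eval x ≫ (t.substIso x fun i => (w i).subst r).hom ≫
        t.evalMap (fun i => ((w i).substIso x r).hom) =
      ((t.subst w).substIso x r).hom ≫ (t.substIso (fun j => (r j).eval x) w).hom := by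
  induction t with
  | unit => exact Category.id_comp (𝟙 (𝟙_ C) ≫ 𝟙 (𝟙_ C))
  | var i => exact (Category.id_comp _).trans ((Category.id_comp _).trans (Category.comp_id _).symm)
  | mul s t hs ht => exact tensor_comp_comp_of_comp hs ht

/-- Substitution of letters for letters. -/
def Coh.substVar : (t : Word ι) → Coh (t.subst .var) t
  | .unit => ident _
  | .var _ => ident _
  | .mul s t => tensor (substVar s) (substVar t)

theorem Coh.eval_substVar (x : ι → C) (t : Word ι) :
    (substVar t).eval x = (t.substIso x .var).hom := by
  induction t with
  | unit => rfl
  | var i => rfl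
  | mul s t hs ht => exact congrArg₂ _ hs ht

end SubstIso

/-! ### Canonical isomorphisms between words over different alphabets -/

section IsCan

variable {ι ι' ι'' κ κ' : Type} {C : Type u} [Category.{v} C] [MonoidalCategory C]
  [SymmetricCategory C]

/-- `IsCan e x s t f` says that `f` is a canonical isomorphism from the word `s` to the word `t`,
with the letters of `s` and `t` matched by `e`. -/
def IsCan (e : ι → ι') (x : ι' → C) (s : Word ι) (t : Word ι') (f : s.eval (x ∘ e) ⟶ t.eval x) :
    Prop :=
  ∃ c : Coh (s.rename e) t, f = (s.renameIso x e).inv ≫ c.eval x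

variable {e : ι → ι'} {x : ι' → C}

/-- Coherence for two alphabets. It suffices that `t` has no repeated letters, since a formal
composite only permutes letters. -/
theorem IsCan.unique {s : Word ι} {t : Word ι'} {f g} (hf : IsCan e x s t f) (hg : IsCan e x s t g)
    (ht : t.letters.Nodup) : f = g := by
  obtain ⟨c, rfl⟩ := hf
  obtain ⟨d, rfl⟩ := hg
  rw [Coh.eval_eq (c.letters_perm.nodup_iff.2 ht) c d]

theorem IsCan.congr {s : Word ι} {t : Word ι'} {f g} (hf : IsCan e x s t f) (h : f = g) :
    IsCan e x s t g :=
  h ▸ hf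

theorem IsCan.isIso {s : Word ι} {t : Word ι'} {f} (hf : IsCan e x s t f) : IsIso f := by
  obtain ⟨c, rfl⟩ := hf
  exact ((s.renameIso x e).symm ≪≫ c.evalIso x).isIso_hom

theorem IsCan.letters_perm {s : Word ι} {t : Word ι'} {f} (hf : IsCan e x s t f) :
    (s.letters.map e).Perm t.letters := by
  obtain ⟨c, -⟩ := hf
  exact s.letters_rename e ▸ c.letters_perm

theorem IsCan.exists_of_perm {s : Word ι} {t : Word ι'} (h : (s.letters.map e).Perm t.letters) :
    ∃ f, IsCan e x s t f := by
  rw [← Word.letters_rename] at h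
  obtain ⟨c⟩ := Coh.nonempty_of_letters_perm h
  exact ⟨_, c, rfl⟩

theorem IsCan.of_coh (x : ι → C) {s t : Word ι} (c : Coh s t) : IsCan id x s t (c.eval x) :=
  ⟨.comp (Coh.substVar s) c, by
    refine ((Iso.inv_comp_eq _).2 ?_).symm
    exact congrArg (· ≫ c.eval x) (Coh.eval_substVar x s)⟩

theorem IsCan.refl (x : ι → C) (s : Word ι) : IsCan id x s s (𝟙 (s.eval x)) :=
  .of_coh x (.ident s)

theorem IsCan.comp {e' : ι' → ι''} {x : ι'' → C} {s : Word ι} {t : Word ι'} {r : Word ι''} {f g}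
    (hf : IsCan e (x ∘ e') s t f) (hg : IsCan e' x t r g) : IsCan (e' ∘ e) x s r (f ≫ g) := by
  obtain ⟨c, rfl⟩ := hf
  obtain ⟨d, rfl⟩ := hg
  refine ⟨.comp (Coh.substAssoc (fun i => .var (e i)) (fun i => .var (e' i)) s).symm
    (.comp (c.subst fun i => .var (e' i)) d), ?_⟩
  have h₁ := Coh.eval_subst x (fun i => .var (e' i)) c
  have h₂ := Coh.eval_substAssoc x (fun i => .var (e i)) (fun i => .var (e' i)) s
  have h₃ : s.evalMap (fun i => ((Word.var (e i)).substIso x (fun i => .var (e' i))).hom) = 𝟙 _ :=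
    s.evalMap_id _
  exact comp_of_conj 
    (A := (Coh.substAssoc (fun i => .var (e i)) (fun i => .var (e' i)) s).evalIso x)
    (S := Word.renameIso x (e' ∘ e) s)
    (h₂.symm.trans (congrArg (fun k => _ ≫ _ ≫ k) h₃)) h₁

theorem IsCan.natural {y : ι' → C} (φ : ∀ i, x i ⟶ y i) {s : Word ι} {t : Word ι'} {g}
    (hg : IsCan e y s t g) :
    ∃ f, IsCan e x s t f ∧ s.evalMap (fun i => φ (e i)) ≫ g = f ≫ t.evalMap φ := by
  obtain ⟨c, rfl⟩ := hg
  exact ⟨_, ⟨c, rfl⟩, conj_natural (S := s.renameIso x e) (S' := s.renameIso y e)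
    (Word.substIso_hom_natural φ _ s) (c.eval_natural φ)⟩

/-- Letters may be renamed before they are matched. -/
theorem IsCan.of_rename {d : ι → ι'} {e : ι' → ι''} {x : ι'' → C} {s : Word ι} {t : Word ι''} {f}
    (hf : IsCan (e ∘ d) x s t f) :
    IsCan e x (s.rename d) t ((s.renameIso (x ∘ e) d).hom ≫ f) := by
  obtain ⟨c, rfl⟩ := hf
  refine ⟨.comp (Coh.substAssoc (fun i => .var (d i)) (fun i => .var (e i)) s) c, ?_⟩
  have h₂ := Coh.eval_substAssoc x (fun i => .var (d i)) (fun i => .var (e i)) s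
  have h₃ : s.evalMap (fun i => ((Word.var (d i)).substIso x (fun i => .var (e i))).hom) = 𝟙 _ :=
    s.evalMap_id _
  exact rename_of_conj (S := s.renameIso x (e ∘ d)) (R := (s.rename d).renameIso x e)
    (h₂.symm.trans (congrArg (fun k => _ ≫ _ ≫ k) h₃))

/-- Index maps such as `σ ∘ σ.symm`, or a concatenation restricted to one block, agree with the
expected ones only pointwise. The correction is an `eqToHom` at each letter, exactly as in the
definition of `U`. -/
theorem IsCan.congr_index {e' : ι → ι'} (h : ∀ i, e' i = e i) {s : Word ι} {t : Word ι'} {f}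
    (hf : IsCan e x s t f) :
    IsCan e' x s t (s.evalMap (fun i => eqToHom (congrArg x (h i))) ≫ f) := by
  obtain rfl : e' = e := funext h
  have : s.evalMap (fun i => eqToHom (congrArg x (h i))) = 𝟙 _ := s.evalMap_id _
  exact hf.congr ((congrArg (· ≫ f) this).trans (Category.id_comp f)).symm

/-- Canonical isomorphisms are compatible with the operad composition of words. -/
theorem IsCan.subst {d : κ → κ'} {w : κ → Word ι} {w' : κ' → Word ι'} {t : Word κ} {t' : Word κ'}
    {f : ∀ i, (w i).eval (x ∘ e) ⟶ (w' (d i)).eval x} {g}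
    (hf : ∀ i, IsCan e x (w i) (w' (d i)) (f i))
    (hg : IsCan d (fun j => (w' j).eval x) t t' g) :
    IsCan e x (t.subst w) (t'.subst w')
      ((t.substIso (x ∘ e) w).hom ≫ t.evalMap f ≫ g ≫ (t'.substIso x w').inv) := by
  choose c hc using hf
  obtain rfl : f = _ := funext hc
  obtain ⟨b, rfl⟩ := hg
  -- Regroup, apply each `c i` inside `t`, regroup back, and finally apply `b` with the words `w'`
  -- substituted for its letters.
  refine ⟨.comp (Coh.substAssoc w _ t) (.comp (Coh.substMap c t)
    (.comp (Coh.substAssoc (fun i => .var (d i)) w' t).symm (b.subst w'))), ?_⟩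
  have h₁ := Coh.eval_substAssoc x w (fun i => .var (e i)) t
  have h₂ := Coh.eval_substMap x c t
  have h₃ := Coh.eval_substAssoc x (fun i => .var (d i)) w' t
  have h₄ := Coh.eval_subst x w' b
  have h₅ : t.evalMap (fun i => ((Word.var (d i)).substIso x w').hom) = 𝟙 _ := t.evalMap_id _
  have h₆ := t.evalMap_comp (fun i => ((w i).substIso x (fun i => .var (e i))).hom)
    (fun i => ((w i).renameIso x e).inv ≫ (c i).eval x)
  have h₇ : (fun i => ((w i).substIso x (fun i => .var (e i))).hom ≫
      ((w i).renameIso x e).inv ≫ (c i).eval x) = fun i => (c i).eval x :=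
    funext fun i => ((w i).renameIso x e).hom_inv_id_assoc _
  exact subst_of_conj (R := (t.subst w).renameIso x e) (R' := t.renameIso _ d)
    (A' := (Coh.substAssoc (fun i => .var (d i)) w' t).evalIso x) h₁
    (h₂.trans (congrArg (_ ≫ ·) ((congrArg t.evalMap h₇).symm.trans h₆)))
    (h₃.symm.trans (congrArg (fun k => _ ≫ _ ≫ k) h₅)) h₄

end IsCan

/-! ## Underlying multicategories -/

section TensorLemmas

variable {C : Type u} [Category.{v} C]

theorem perm_comp_eq {a b c d e z : C} {p : a ⟶ b} {q : b ⟶ c} {r : b ⟶ d} {r' : d ⟶ c} {m : c ⟶ e}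
    {f : e ⟶ z} (h : q = r ≫ r') : p ≫ q ≫ m ≫ f = ((p ≫ r ≫ r') ≫ m) ≫ f := by
  simp only [h, Category.assoc]

theorem multicomp_eq {a b c d e h i j k z : C} {p : a ⟶ b} {q : b ⟶ c} {S : b ⟶ d} {A : d ⟶ c}
    {M : c ⟶ e} {B : d ⟶ e} {G : e ⟶ h} {H : c ⟶ h} {m₀ : h ⟶ i} {f : i ⟶ z} {m₁ : e ⟶ j} {T : j ⟶ i}
    {S' : k ≅ j} (h₄ : q = S ≫ A) (h₅ : B = A ≫ M) (h₆ : H = M ≫ G) (h₁ : G ≫ m₀ = m₁ ≫ T) :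
    p ≫ q ≫ H ≫ m₀ ≫ f = (p ≫ S ≫ B ≫ m₁ ≫ S'.inv) ≫ S'.hom ≫ T ≫ f := by
  simp only [h₄, h₅, h₆, Category.assoc, Iso.inv_hom_id_assoc]
  rw [reassoc_of% h₁]

theorem multicomp_assoc_eq {a a' b c c' d d' e z : C} {A : a ⟶ a'} {S : a' ⟶ b} {T : b ⟶ c}
    {R : a ⟶ d} {R' : d ⟶ c} {H : d ⟶ d'} {S' : d' ⟶ c'} {H' : c ⟶ c'} {G : c' ⟶ e} {f : e ⟶ z}
    {TH : b ⟶ c'} {THG : b ⟶ e} (h₁ : A ≫ S ≫ T = R ≫ R') (h₂ : H ≫ S' = R' ≫ H')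
    (h₃ : THG = TH ≫ G) (h₄ : TH = T ≫ H') :
    R ≫ H ≫ S' ≫ G ≫ f = A ≫ S ≫ THG ≫ f := by
  rw [reassoc_of% h₂, ← reassoc_of% h₁, h₃, h₄, Category.assoc, Category.assoc]

end TensorLemmas

/-! ### Concatenation of tuples -/

section Concat

variable {α : Type*} {n : ℕ} {k : Fin n → ℕ}

theorem concat_apply (x : ∀ s, Fin (k s) → α) (s : Fin n) (r : Fin (k s)) :
    concat x (finSigmaFinEquiv ⟨s, r⟩) = x s r :=
  congrArg (fun q : (Σ s, Fin (k s)) => x q.1 q.2) (finSigmaFinEquiv.symm_apply_apply _)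

theorem concat_injective {x : ∀ s, Fin (k s) → α}
    (h : Function.Injective fun q : (Σ s, Fin (k s)) => x q.1 q.2) :
    Function.Injective (concat x) :=
  h.comp finSigmaFinEquiv.symm.injective

/-- Reduces identities between nested concatenations to identities of lists, which avoids arithmetic
with positions. The induction splits off the last block, to match `Fin.sum_univ_castSucc`. -/
theorem ofFn_concat : ∀ {n : ℕ} {k : Fin n → ℕ} (x : ∀ s, Fin (k s) → α),
    List.ofFn (concat x) = (List.ofFn fun s => List.ofFn (x s)).flatten
  | 0, k, x => by simp
  | n + 1, k, x => by
    have h : concat x = Fin.append (concat fun s : Fin n => x s.castSucc) (x (Fin.last n)) ∘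
        Fin.cast (Fin.sum_univ_castSucc k) := by
      funext p
      obtain ⟨⟨s, r⟩, rfl⟩ := finSigmaFinEquiv.surjective p
      rw [concat_apply]
      induction s using Fin.lastCases with
      | last =>
        have : Fin.cast (Fin.sum_univ_castSucc k) (finSigmaFinEquiv ⟨Fin.last n, r⟩) =
            Fin.natAdd _ r := by
          ext
          simp only [Fin.val_cast, finSigmaFinEquiv_apply, Fin.val_natAdd]
          rfl
        rw [Function.comp_apply, this, Fin.append_right]
      | cast s =>
        have : Fin.cast (Fin.sum_univ_castSucc k) (finSigmaFinEquiv ⟨s.castSucc, r⟩) =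
            Fin.castAdd _ (finSigmaFinEquiv ⟨s, r⟩) := by
          ext
          simp [finSigmaFinEquiv_apply]
        rw [Function.comp_apply, this, Fin.append_left, concat_apply]
    rw [List.ofFn_succ_last, List.flatten_concat, ← ofFn_concat, h, ← List.ofFn_fin_append]
    exact List.ofFn_congr (Fin.sum_univ_castSucc k) _

theorem exists_cast_of_ofFn_eq {m n : ℕ} {e : Fin m → α} {e' : Fin n → α}
    (h : List.ofFn e = List.ofFn e') : ∃ h : m = n, ∀ i, e i = e' (Fin.cast h i) := by
  obtain rfl : m = n := by simpa using congrArg List.length h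
  exact ⟨rfl, fun i => congrFun (List.ofFn_injective h) i⟩

end Concat

/-! ### Multimorphisms represented by morphisms on words -/

section Rep

variable {ι ι' : Type} {C : Type u} [Category.{v} C] [MonoidalCategory C]

theorem Word.eqToHom_eval_rename {κ : Type} {x : ι → C} {y : κ → C} (d : ι → κ)
    (h : ∀ i, y (d i) = x i) (t : Word ι) (h' : (t.rename d).eval y = t.eval x) :
    eqToHom h' = (t.renameIso y d).hom ≫ t.evalMap (fun i => eqToHom (h i)) := by
  have h₁ : (t.renameIso y d).hom = eqToHom _ := t.substIso_hom_eq_eqToHom y _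
  rw [h₁]
  exact ((congrArg (eqToHom _ ≫ ·) (t.evalMap_eqToHom h)).trans (eqToHom_trans _ _)).symm

theorem Y.eqToHom_obj_gamma {n : ℕ} {k : Fin n → ℕ} (t : Y n) (s : ∀ i, Y (k i))
    (x : ∀ i, Fin (k i) → C) :
    eqToHom (t.obj_gamma s x) =
      (t.1.substIso (concat x) fun i => (s i).1.rename fun r => finSigmaFinEquiv ⟨i, r⟩).hom ≫
        t.1.evalMap fun i => ((s i).1.renameIso (concat x) fun r => finSigmaFinEquiv ⟨i, r⟩).hom ≫
          (s i).1.evalMap fun r => eqToHom (concat_apply x i r) := by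
  have h : ∀ i, ((s i).1.rename fun r => finSigmaFinEquiv ⟨i, r⟩).eval (concat x) =
      (s i).1.eval (x i) := fun i =>
    ((s i).1.eval_subst _ _).trans (congrArg (s i).1.eval (funext fun r => concat_apply x i r))
  have h₁ : (fun i => ((s i).1.renameIso (concat x) fun r => finSigmaFinEquiv ⟨i, r⟩).hom ≫
      (s i).1.evalMap fun r => eqToHom (concat_apply x i r)) = fun i => eqToHom (h i) :=
    funext fun i => ((s i).1.eqToHom_eval_rename _ (fun r => concat_apply x i r) (h i)).symm
  have h₂ := t.1.substIso_hom_eq_eqToHom (concat x)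
    fun i => (s i).1.rename fun r => finSigmaFinEquiv ⟨i, r⟩
  exact ((congrArg₂ (· ≫ ·) h₂ ((congrArg t.1.evalMap h₁).trans (t.1.evalMap_eqToHom h))).trans
    (eqToHom_trans _ _)).symm

theorem Y.letters_perm {n : ℕ} (t : Y n) : (List.finRange n).Perm t.1.letters :=
  (List.perm_ext_iff_of_nodup (List.nodup_finRange n) t.2.1).2 fun i => by
    simp [List.mem_finRange, t.2.2 i]

variable [SymmetricCategory C]

/-- `Rep κ e X t f g` says that the multimorphism `g` of `U κ`, with source `X ∘ e`, is represented
by the morphism `f` on the value of the word `t`. -/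
def Rep (κ : Choice C) {n : ℕ} (e : Fin n → ι) (X : ι → C) (t : Word ι) {z : C}
    (f : t.eval X ⟶ z) (g : κ.bar (X ∘ e) ⟶ z) : Prop :=
  ∃ m, IsCan e X (κ n (X ∘ e)).1 t m ∧ g = m ≫ f

/-- `e` lists the letters of `t`, without repetition. -/
def Enumerates {n : ℕ} (e : Fin n → ι) (t : Word ι) : Prop :=
  t.letters.Nodup ∧ ((List.finRange n).map e).Perm t.letters

variable {κ : Choice C} {n : ℕ} {e : Fin n → ι} {X : ι → C} {t : Word ι} {z : C}

theorem Rep.enumerates {f : t.eval X ⟶ z} {g} (h : Rep κ e X t f g) (he : Function.Injective e) :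
    Enumerates e t := by
  obtain ⟨m, hm, -⟩ := h
  have := ((κ n (X ∘ e)).letters_perm.map e).trans hm.letters_perm
  exact ⟨this.nodup_iff.1 ((List.nodup_finRange n).map he), this⟩

theorem Enumerates.exists_rep (h : Enumerates e t) (κ : Choice C) (f : t.eval X ⟶ z) :
    ∃ g, Rep κ e X t f g := by
  obtain ⟨m, hm⟩ := IsCan.exists_of_perm (x := X)
    (((κ n (X ∘ e)).letters_perm.map e).symm.trans h.2)
  exact ⟨_, m, hm, rfl⟩

theorem Enumerates.exists_represents (h : Enumerates e t) (g : κ.bar (X ∘ e) ⟶ z) :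
    ∃ f, Rep κ e X t f g := by
  obtain ⟨m, hm⟩ := IsCan.exists_of_perm (x := X)
    (((κ n (X ∘ e)).letters_perm.map e).symm.trans h.2)
  let i := @asIso _ _ _ _ m hm.isIso
  exact ⟨i.inv ≫ g, m, hm, (i.hom_inv_id_assoc g).symm⟩

theorem Rep.unique {f : t.eval X ⟶ z} {g g'} (h : Rep κ e X t f g) (h' : Rep κ e X t f g')
    (ht : t.letters.Nodup) : g = g' := by
  obtain ⟨m, hm, rfl⟩ := h
  obtain ⟨m', hm', rfl⟩ := h'
  rw [hm.unique hm' ht]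

theorem Rep.unique_left {f f' : t.eval X ⟶ z} {g} (h : Rep κ e X t f g) (h' : Rep κ e X t f' g)
    (ht : t.letters.Nodup) : f = f' := by
  obtain ⟨m, hm, rfl⟩ := h
  obtain ⟨m', hm', h⟩ := h'
  have := hm.isIso
  rw [← hm.unique hm' ht] at h
  exact (cancel_epi m).1 h

theorem Rep.congr {f f' : t.eval X ⟶ z} {g} (h : Rep κ e X t f g) (hf : f = f') :
    Rep κ e X t f' g :=
  hf ▸ h

theorem Rep.self (x : Fin n → C) (f : κ.bar x ⟶ z) : Rep κ id x (κ n x).1 f f :=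
  ⟨_, IsCan.refl x _, (Category.id_comp _).symm⟩

/-- Every multimorphism has a representative on its own word with the letters renamed. Several
inputs can thus be placed in one disjoint union of alphabets. -/
theorem Rep.rename (e : Fin n → ι) (X : ι → C) (g : κ.bar (X ∘ e) ⟶ z) :
    Rep κ e X ((κ n (X ∘ e)).1.rename e) (((κ n (X ∘ e)).1.renameIso X e).hom ≫ g) g :=
  ⟨(((κ n (X ∘ e)).1.renameIso X e).inv), ⟨.ident _, (Category.comp_id _).symm⟩,
    (Iso.inv_hom_id_assoc ((κ n (X ∘ e)).1.renameIso X e) g).symm⟩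

theorem Rep.of_isCan {a : ι → ι'} {X : ι' → C} {t' : Word ι'} {f : t.eval (X ∘ a) ⟶ z}
    {f' : t'.eval X ⟶ z} {g m} (h : Rep κ e (X ∘ a) t f g) (hm : IsCan a X t t' m)
    (hf : f = m ≫ f') : Rep κ (a ∘ e) X t' f' g := by
  obtain ⟨p, hp, rfl⟩ := h
  exact ⟨_, hp.comp hm, by rw [hf]; exact (Category.assoc p m f').symm⟩

/-- The representing morphism stays the same; only the order in which the letters are listed
changes. -/
theorem Rep.perm {f : t.eval X ⟶ z} {g} (h : Rep κ e X t f g) (σ : Equiv.Perm (Fin n)) :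
    Rep κ (e ∘ σ) X t f ((U κ).perm σ g) := by
  obtain ⟨m, hm, rfl⟩ := h
  have h₁ := IsCan.of_coh ((X ∘ e) ∘ σ)
    (Y.nonempty_coh (κ n ((X ∘ e) ∘ σ)) ((κ n (X ∘ e)).act σ)).some
  -- Acting by `σ` renames letters by `σ.symm`; matching them along `σ` restores the original
  -- letters.
  have h₂ := ((IsCan.refl (X ∘ e) (κ n (X ∘ e)).1).congr_index
    (e' := σ ∘ σ.symm) (fun i => σ.apply_symm_apply i)).of_rename
  refine ⟨_, (h₁.comp h₂).comp hm, ?_⟩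
  have h₃ := (κ n (X ∘ e)).1.eqToHom_eval_rename (x := X ∘ e) (y := (X ∘ e) ∘ σ) σ.symm
    (fun i => congrArg (X ∘ e) (σ.apply_symm_apply i)) ((κ n (X ∘ e)).obj_act σ (X ∘ e))
  exact perm_comp_eq (h₃.trans (congrArg (_ ≫ ·) (Category.comp_id _).symm))

theorem Rep.ident (X : ι → C) (i : ι) :
    Rep κ (fun _ : Fin 1 => i) X (.var i) (𝟙 (X i)) ((U κ).ident (X i)) := by
  have h₁ := IsCan.of_coh (fun _ : Fin 1 => X i)
    (Y.nonempty_coh (κ 1 fun _ => X i) Y.one).some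
  have h₂ : IsCan (fun _ : Fin 1 => i) X (.var 0) (.var i) (𝟙 (X i)) :=
    ⟨.ident _, (Category.comp_id _).symm⟩
  exact ⟨_, h₁.comp h₂, ((Category.comp_id _).trans (Category.comp_id _)).symm⟩

/-- Multicomposition becomes substitution, independently of the words chosen by `κ`. -/
theorem Rep.comp {k : Fin n → ℕ} {d : Fin n → ι'} {E : ∀ s, Fin (k s) → ι} {y : ι' → C}
    {t : Word ι'} {w : ι' → Word ι} {f : t.eval y ⟶ z} {F : κ.bar (y ∘ d) ⟶ z}
    {g : ∀ i, (w i).eval X ⟶ y i} {G : ∀ s, κ.bar (X ∘ E s) ⟶ y (d s)}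
    (hF : Rep κ d y t f F) (hG : ∀ s, Rep κ (E s) X (w (d s)) (g (d s)) (G s)) :
    Rep κ (concat E) X (t.subst w) ((t.substIso X w).hom ≫ t.evalMap g ≫ f)
      ((U κ).comp (x := fun s => X ∘ E s) (y := y ∘ d) F G) := by
  obtain ⟨m₀, hm₀, rfl⟩ := hF
  choose m hm hG using hG
  obtain rfl : G = _ := funext hG
  obtain ⟨m₁, hm₁, h₁⟩ := hm₀.natural g
  have h₂ := IsCan.of_coh (X ∘ concat E) (Y.nonempty_coh (κ _ (concat fun s => X ∘ E s))
    ((κ n (y ∘ d)).gamma fun s => κ (k s) (X ∘ E s))).some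
  have h₃ := IsCan.subst (fun s => ((hm s).congr_index
    (e' := concat E ∘ fun r => finSigmaFinEquiv ⟨s, r⟩) (concat_apply E s)).of_rename) hm₁
  refine ⟨_, h₂.comp h₃, ?_⟩
  have h₄ := Y.eqToHom_obj_gamma (κ n (y ∘ d)) (fun s => κ (k s) (X ∘ E s)) fun s => X ∘ E s
  have h₅ := (κ n (y ∘ d)).1.evalMap_comp
    (fun s => ((κ (k s) (X ∘ E s)).1.renameIso (concat fun s => X ∘ E s)
      fun r => finSigmaFinEquiv ⟨s, r⟩).hom ≫
      (κ (k s) (X ∘ E s)).1.evalMap fun r => eqToHom (concat_apply (fun s => X ∘ E s) s r)) m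
  have h₆ := (κ n (y ∘ d)).1.evalMap_comp m (fun s => g (d s))
  simp only [Category.assoc] at h₅
  exact multicomp_eq h₄ h₅ h₆ h₁

/-- The form in which axioms are proved: the same representing morphism, and enumerations that agree
up to an equality of arities. Injectivity of the enumeration rules out repeated letters. -/
theorem Rep.mor_eq {n' : ℕ} {e' : Fin n' → ι} {f : t.eval X ⟶ z} {g g'} (h : Rep κ e X t f g)
    (h' : Rep κ e' X t f g') (he : Function.Injective e) (hn : n = n')
    (hee' : ∀ i, e i = e' (Fin.cast hn i)) :
    MulticategoryData.mor (M := U κ) g = MulticategoryData.mor (M := U κ) g' := by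
  subst hn
  obtain rfl : e = e' := funext hee'
  rw [h.unique h' (h.enumerates he).1]

/-! ### The multicategory axioms for `U κ` -/

theorem U_perm_one {x : Fin n → C} (f : κ.bar x ⟶ z) : (U κ).perm (x := x) 1 f = f :=
  Rep.unique (e := id) (X := x) ((Rep.self x f).perm 1) (Rep.self x f) (κ n x).2.1

theorem U_perm_mul {x : Fin n → C} (σ τ : Equiv.Perm (Fin n)) (f : κ.bar x ⟶ z) :
    (U κ).perm (x := x) (σ * τ) f = (U κ).perm τ ((U κ).perm (x := x) σ f) :=
  ((Rep.self x f).perm (σ * τ)).unique (((Rep.self x f).perm σ).perm τ) (κ n x).2.1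

theorem U_ident_comp {x : Fin n → C} (f : κ.bar x ⟶ z) :
    MulticategoryData.mor ((U κ).comp (k := fun _ => n) (x := fun _ => x) ((U κ).ident z)
      fun _ : Fin 1 => f) = MulticategoryData.mor (M := U κ) (x := x) f := by
  have h := (Rep.ident (κ := κ) (fun _ : Fin 1 => z) 0).comp (k := fun _ => n) (E := fun _ => id)
    (w := fun _ => (κ n x).1) (g := fun _ => f) (G := fun _ => f) fun _ => Rep.self x f
  obtain ⟨hn, hi⟩ := exists_cast_of_ofFn_eq (e := concat fun _ : Fin 1 => (id : Fin n → Fin n))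
    (e' := id) (by rw [ofFn_concat]; simp)
  refine Rep.mor_eq (h.congr ?_) (Rep.self x f)
    (concat_injective (x := fun _ : Fin 1 => (id : Fin n → Fin n)) ?_) hn hi
  · exact (Category.id_comp (f ≫ 𝟙 z)).trans (Category.comp_id f)
  · rintro ⟨s, r⟩ ⟨s', r'⟩ hr
    obtain rfl := Subsingleton.elim s s'
    exact congrArg _ hr

theorem U_comp_ident {x : Fin n → C} (f : κ.bar x ⟶ z) :
    MulticategoryData.mor ((U κ).comp (x := fun s _ => x s) (y := x) f
      fun s => (U κ).ident (x s)) = MulticategoryData.mor (M := U κ) (x := x) f := by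
  -- Substituting each letter for itself must be undone by the formal composite `Coh.substVar`,
  -- which evaluates to `substIso`.
  have h := ((Rep.self (κ := κ) x f).comp (k := fun _ => 1) (E := fun s _ => s) (w := .var)
    (g := fun i => 𝟙 (x i)) fun s => Rep.ident x s).of_isCan (a := id) (f' := f)
    (IsCan.of_coh x (Coh.substVar _)) (by
      have := (κ n x).1.evalMap_id x
      rw [Coh.eval_substVar]
      exact congrArg (_ ≫ ·) ((congrArg (· ≫ f) this).trans (Category.id_comp f)))
  obtain ⟨hn, hi⟩ := exists_cast_of_ofFn_eq (e := concat fun (s : Fin n) (_ : Fin 1) => s)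
    (e' := id) (by
      rw [ofFn_concat]
      simp [List.ofFn_eq_map, ← List.flatMap_def])
  refine Rep.mor_eq h (Rep.self x f)
    (concat_injective (x := fun (s : Fin n) (_ : Fin 1) => s) ?_) hn hi
  rintro ⟨s, r⟩ ⟨s', r'⟩ hr
  obtain rfl : s = s' := hr
  rw [Subsingleton.elim r r']

theorem U_assoc {k : Fin n → ℕ} {l : ∀ s, Fin (k s) → ℕ} {w : ∀ s r, Fin (l s r) → C}
    {x : ∀ s, Fin (k s) → C} {y : Fin n → C} (f : κ.bar y ⟶ z) (g : ∀ s, κ.bar (x s) ⟶ y s)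
    (h : ∀ s r, κ.bar (w s r) ⟶ x s r) :
    MulticategoryData.mor (M := U κ) ((U κ).comp
      (x := fun p => w (finSigmaFinEquiv.symm p).1 (finSigmaFinEquiv.symm p).2) (y := concat x)
      ((U κ).comp (x := x) (y := y) f g)
      (fun p => h (finSigmaFinEquiv.symm p).1 (finSigmaFinEquiv.symm p).2)) =
    MulticategoryData.mor (M := U κ) ((U κ).comp (x := fun s => concat (w s)) (y := y) f
      (fun s => (U κ).comp (x := w s) (y := x s) (g s) (h s))) := by
  -- The letters are the input positions themselves, so they are distinct even when the objects
  -- placed there coincide.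
  let I₁ := Σ s, Fin (k s)
  let I₂ := Σ s, Σ r, Fin (l s r)
  let X₁ : I₁ → C := fun p => x p.1 p.2
  let X₂ : I₂ → C := fun q => w q.1 q.2.1 q.2.2
  let i₁ : ∀ s, Fin (k s) → I₁ := fun s r => ⟨s, r⟩
  let i₂ : ∀ p : I₁, Fin (l p.1 p.2) → I₂ := fun p q => ⟨p.1, p.2, q⟩
  let L : ∀ s, Word I₁ := fun s => (κ (k s) (x s)).1.rename (i₁ s)
  let M : ∀ p, Word I₂ := fun p => (κ _ (w p.1 p.2)).1.rename (i₂ p)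
  let g' : ∀ s, (L s).eval X₁ ⟶ y s := fun s => ((κ (k s) (x s)).1.renameIso X₁ (i₁ s)).hom ≫ g s
  let h' : ∀ p, (M p).eval X₂ ⟶ X₁ p := fun p =>
    ((κ _ (w p.1 p.2)).1.renameIso X₂ (i₂ p)).hom ≫ h p.1 p.2
  have hg : ∀ s, Rep κ (i₁ s) X₁ (L s) (g' s) (g s) := fun s => Rep.rename (i₁ s) X₁ (g s)
  have hh : ∀ p, Rep κ (i₂ p) X₂ (M p) (h' p) (h p.1 p.2) := fun p =>
    Rep.rename (i₂ p) X₂ (h p.1 p.2)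
  have h₁ := ((Rep.self (κ := κ) y f).comp hg).comp (w := M) (g := h') (fun p => hh (concat i₁ p))
  have h₂ := (Rep.self (κ := κ) y f).comp (E := fun s => concat fun r => i₂ ⟨s, r⟩)
    (w := fun s => (L s).subst M)
    (g := fun s => (((L s).substIso X₂ M).hom ≫ (L s).evalMap h') ≫ g' s)
    (G := fun s => (U κ).comp (x := w s) (y := x s) (g s) (h s))
    (fun s => ((hg s).comp (w := M) (g := h') (fun r => hh ⟨s, r⟩)).congr
      (Category.assoc _ _ _).symm)
  -- The two bracketings substitute in different orders. `Coh.substAssoc` carries the first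
  -- representative to the word used for the second.
  have h₃ := h₁.of_isCan (a := id) (IsCan.of_coh X₂ (Coh.substAssoc L M _))
    (multicomp_assoc_eq (Coh.eval_substAssoc X₂ L M _) (Word.substIso_hom_natural h' L _)
      ((κ n y).1.evalMap_comp _ _) ((κ n y).1.evalMap_comp _ _))
  obtain ⟨hn, hi⟩ := exists_cast_of_ofFn_eq
    (e := concat fun p => i₂ (concat i₁ p))
    (e' := concat fun s => concat fun r => i₂ ⟨s, r⟩) (by
      rw [ofFn_concat, ofFn_concat]
      have h₄ := ofFn_concat fun s r => List.ofFn (i₂ ⟨s, r⟩)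
      have h₅ : ∀ s, List.ofFn (concat fun r => i₂ ⟨s, r⟩) =
        (List.ofFn fun r => List.ofFn (i₂ ⟨s, r⟩)).flatten := fun s => ofFn_concat _
      refine (congrArg List.flatten h₄).trans ?_
      rw [List.flatten_flatten, List.map_ofFn]
      exact (congrArg (fun F => (List.ofFn F).flatten) (funext h₅)).symm)
  refine Rep.mor_eq h₃ h₂ (concat_injective (x := fun p => i₂ (concat i₁ p)) ?_) hn hi
  exact ((Equiv.sigmaCongrLeft (β := fun p : I₁ => Fin (l p.1 p.2)) finSigmaFinEquiv.symm).trans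
    (Equiv.sigmaAssoc fun s r => Fin (l s r))).injective

/-- Both sides have the same representative on the disjoint union of the blocks; `blockPerm` is by
construction the permutation that relates the two enumerations. -/
theorem U_perm_comp {k : Fin n → ℕ} {x : ∀ s, Fin (k s) → C} {y : Fin n → C}
    (σ : Equiv.Perm (Fin n)) (f : κ.bar y ⟶ z) (g : ∀ s, κ.bar (x s) ⟶ y s) :
    MulticategoryData.mor (M := U κ) ((U κ).comp (x := fun s => x (σ s)) (y := y ∘ σ)
      ((U κ).perm (x := y) σ f) (fun s => g (σ s))) =
    MulticategoryData.mor ((U κ).perm (blockPerm σ k) ((U κ).comp (x := x) (y := y) f g)) := by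
  let I := Σ s, Fin (k s)
  let X : I → C := fun p => x p.1 p.2
  let i : ∀ s, Fin (k s) → I := fun s r => ⟨s, r⟩
  have hg : ∀ s, Rep κ (i s) X _ _ (g s) := fun s => Rep.rename (i s) X (g s)
  have h₁ := ((Rep.self (κ := κ) y f).perm σ).comp
    (E := fun s => i (σ s)) (w := fun s => (κ (k s) (x s)).1.rename (i s))
    (g := fun s => ((κ (k s) (x s)).1.renameIso X (i s)).hom ≫ g s) (G := fun s => g (σ s))
    (fun s => hg (σ s))
  have h₂ := ((Rep.self (κ := κ) y f).comp
    (E := i) (w := fun s => (κ (k s) (x s)).1.rename (i s))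
    (g := fun s => ((κ (k s) (x s)).1.renameIso X (i s)).hom ≫ g s) (G := g) hg).perm (blockPerm σ k)
  refine Rep.mor_eq h₁ h₂ (concat_injective ?_) (Equiv.sum_comp σ k) fun p => ?_
  · exact (Equiv.sigmaCongrLeft (β := fun s => Fin (k s)) σ).injective
  · exact (finSigmaFinEquiv.symm_apply_apply
      (Equiv.sigmaCongrLeft (β := fun s => Fin (k s)) σ (finSigmaFinEquiv.symm p))).symm

theorem U_comp_perm {k : Fin n → ℕ} {x : ∀ s, Fin (k s) → C} {y : Fin n → C}
    (τ : ∀ s, Equiv.Perm (Fin (k s))) (f : κ.bar y ⟶ z) (g : ∀ s, κ.bar (x s) ⟶ y s) :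
    MulticategoryData.mor (M := U κ) ((U κ).comp (x := fun s => x s ∘ τ s) (y := y) f
      (fun s => (U κ).perm (x := x s) (τ s) (g s))) =
    MulticategoryData.mor ((U κ).perm (sumPerm τ) ((U κ).comp (x := x) (y := y) f g)) := by
  let I := Σ s, Fin (k s)
  let X : I → C := fun p => x p.1 p.2
  let i : ∀ s, Fin (k s) → I := fun s r => ⟨s, r⟩
  have hg : ∀ s, Rep κ (i s) X _ _ (g s) := fun s => Rep.rename (i s) X (g s)
  have h₁ := (Rep.self (κ := κ) y f).comp
    (E := fun s => i s ∘ τ s) (w := fun s => (κ (k s) (x s)).1.rename (i s))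
    (g := fun s => ((κ (k s) (x s)).1.renameIso X (i s)).hom ≫ g s)
    (G := fun s => (U κ).perm (x := x s) (τ s) (g s)) (fun s => (hg s).perm (τ s))
  have h₂ := ((Rep.self (κ := κ) y f).comp
    (E := i) (w := fun s => (κ (k s) (x s)).1.rename (i s))
    (g := fun s => ((κ (k s) (x s)).1.renameIso X (i s)).hom ≫ g s) (G := g) hg).perm (sumPerm τ)
  refine Rep.mor_eq h₁ h₂ (concat_injective ?_) rfl fun p => ?_
  · exact (Equiv.sigmaCongrRight τ).injective
  · simp [sumPerm, concat, i]

theorem isMulticategory_U (κ : Choice C) : IsMulticategory (U κ) where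
  perm_one f := U_perm_one f
  perm_mul σ τ f := U_perm_mul σ τ f
  ident_comp f := U_ident_comp f
  comp_ident f := U_comp_ident f
  assoc f g h := U_assoc f g h
  perm_comp σ f g := U_perm_comp σ f g
  comp_perm τ f g := U_comp_perm τ f g

end Rep

/-! ## Lax symmetric monoidal functors -/

section LaxLemmas

variable {C : Type u₁} [Category.{v₁} C] {D : Type u₂} [Category.{v₂} D] (F : C ⥤ D)

theorem lax_comp_of_comp {a b c : D} {a' b' c' : C} {p : a ⟶ b} {q : b ⟶ c} {p' : a' ⟶ b'}
    {q' : b' ⟶ c'} {s : a ⟶ F.obj a'} {t : b ⟶ F.obj b'} {w : c ⟶ F.obj c'}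
    (h : p ≫ t = s ≫ F.map p') (h' : q ≫ w = t ≫ F.map q') :
    (p ≫ q) ≫ w = s ≫ F.map (p' ≫ q') := by
  rw [F.map_comp, ← reassoc_of% h, Category.assoc, h']

theorem lax_inv {a b : D} {a' b' : C} {i : a ≅ b} {i' : a' ≅ b'} {p : a ⟶ F.obj a'}
    {q : b ⟶ F.obj b'} (h : i.hom ≫ q = p ≫ F.map i'.hom) : i.inv ≫ p = q ≫ F.map i'.inv := by
  rw [Iso.inv_comp_eq, reassoc_of% h, ← F.map_comp, Iso.hom_inv_id, F.map_id, Category.comp_id]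

theorem lax_map_eq {a b d : D} {a' b' c : C} {p : a ⟶ b} {q : b ⟶ d} {l : b ⟶ F.obj a'}
    {l' : d ⟶ F.obj b'} {m : a' ⟶ b'} {f : b' ⟶ c} (h : q ≫ l' = l ≫ F.map m) :
    p ≫ l ≫ F.map (m ≫ f) = (p ≫ q) ≫ l' ≫ F.map f := by
  rw [F.map_comp, ← reassoc_of% h, Category.assoc]

theorem lax_multicomp_eq {a b c d : D} {a' b' c' d' : C} {l : a ⟶ F.obj a'} {S : a' ⟶ b'}
    {S' : a ⟶ b} {T : b ⟶ c} {l' : c ⟶ F.obj b'} {g : b' ⟶ c'} {G : c ⟶ d} {l'' : d ⟶ F.obj c'}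
    {f : c' ⟶ d'} {TG : b ⟶ d} (h₁ : l ≫ F.map S = S' ≫ T ≫ l') (h₂ : G ≫ l'' = l' ≫ F.map g)
    (h₃ : TG = T ≫ G) :
    S' ≫ TG ≫ l'' ≫ F.map f = l ≫ F.map (S ≫ g ≫ f) := by
  rw [F.map_comp, F.map_comp, reassoc_of% h₁, h₃, Category.assoc, reassoc_of% h₂]

theorem lax_comp_eq {a : D} {b c d : C} {l : a ⟶ F.obj b} {m : b ⟶ c} {f : c ⟶ d}
    {k : a ⟶ F.obj c} (h : k = l ≫ F.map m) : l ≫ F.map (m ≫ f) = k ≫ F.map f := by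
  rw [F.map_comp, h, Category.assoc]

open Functor.LaxMonoidal

variable [MonoidalCategory C] [MonoidalCategory D] [F.LaxMonoidal]

theorem lax_tensor_of_comp {a b c d : D} {a' b' c' d' : C} {p : a ⟶ b} {q : c ⟶ d} {p' : a' ⟶ b'}
    {q' : c' ⟶ d'} {s : a ⟶ F.obj a'} {t : b ⟶ F.obj b'} {w : c ⟶ F.obj c'} {r : d ⟶ F.obj d'}
    (h : p ≫ t = s ≫ F.map p') (h' : q ≫ r = w ≫ F.map q') :
    (p ⊗ₘ q) ≫ (t ⊗ₘ r) ≫ μ F b' d' = ((s ⊗ₘ w) ≫ μ F a' c') ≫ F.map (p' ⊗ₘ q') := by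
  rw [tensorHom_comp_tensorHom_assoc, h, h', Category.assoc, ← μ_natural,
    tensorHom_comp_tensorHom_assoc]

theorem lax_associator {a b c : D} {a' b' c' : C} (p : a ⟶ F.obj a') (q : b ⟶ F.obj b')
    (r : c ⟶ F.obj c') :
    (α_ a b c).hom ≫ (p ⊗ₘ ((q ⊗ₘ r) ≫ μ F b' c')) ≫ μ F a' (b' ⊗ c') =
      ((((p ⊗ₘ q) ≫ μ F a' b') ⊗ₘ r) ≫ μ F (a' ⊗ b') c') ≫ F.map (α_ a' b' c').hom := by
  have h₁ : (p ⊗ₘ ((q ⊗ₘ r) ≫ μ F b' c')) = (p ⊗ₘ (q ⊗ₘ r)) ≫ F.obj a' ◁ μ F b' c' := by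
    rw [← id_tensorHom, tensorHom_comp_tensorHom, Category.comp_id]
  have h₂ : (((p ⊗ₘ q) ≫ μ F a' b') ⊗ₘ r) = ((p ⊗ₘ q) ⊗ₘ r) ≫ μ F a' b' ▷ F.obj c' := by
    rw [← tensorHom_id, tensorHom_comp_tensorHom, Category.comp_id]
  rw [h₁, h₂, Category.assoc, Category.assoc, Category.assoc, associativity,
    associator_naturality_assoc]

theorem lax_leftUnitor {a : D} {a' : C} (p : a ⟶ F.obj a') :
    (λ_ a).hom ≫ p = ((ε F ⊗ₘ p) ≫ μ F (𝟙_ C) a') ≫ F.map (λ_ a').hom := by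
  rw [Category.assoc, tensorHom_def'_assoc, ← left_unitality]
  simp

theorem lax_rightUnitor {a : D} {a' : C} (p : a ⟶ F.obj a') :
    (ρ_ a).hom ≫ p = ((p ⊗ₘ ε F) ≫ μ F a' (𝟙_ C)) ≫ F.map (ρ_ a').hom := by
  rw [Category.assoc, MonoidalCategory.tensorHom_def, Category.assoc, ← right_unitality]
  simp

theorem lax_subst_tensor {a b e h : D} {a' b' c' d' : C} {p : a ⟶ F.obj a'} {q : b ⟶ F.obj b'}
    {s : a' ⟶ c'} {t : b' ⟶ d'} {s' : a ⟶ e} {t' : b ⟶ h} {m n : D} {u' : e ⟶ m} {w' : h ⟶ n}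
    {l : m ⟶ F.obj c'} {l' : n ⟶ F.obj d'} (E : p ≫ F.map s = s' ≫ u' ≫ l)
    (E' : q ≫ F.map t = t' ≫ w' ≫ l') :
    ((p ⊗ₘ q) ≫ μ F a' b') ≫ F.map (s ⊗ₘ t) =
      (s' ⊗ₘ t') ≫ (u' ⊗ₘ w') ≫ (l ⊗ₘ l') ≫ μ F c' d' := by
  rw [Category.assoc, ← μ_natural, tensorHom_comp_tensorHom_assoc, E, E']
  simp only [tensorHom_comp_tensorHom_assoc]

theorem lax_comp_mul {a b a' b' : C} {s t : D} (p : s ⟶ F.obj a) (q : t ⟶ F.obj b) (f : a ⟶ a')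
    (g : b ⟶ b') {c : C} (m : a' ⊗ b' ⟶ c) :
    ((p ≫ F.map f) ⊗ₘ (q ≫ F.map g)) ≫ μ F a' b' ≫ F.map m =
      ((p ⊗ₘ q) ≫ μ F a b) ≫ F.map ((f ⊗ₘ g) ≫ m) := by
  rw [F.map_comp, Category.assoc, ← μ_natural_assoc, tensorHom_comp_tensorHom_assoc]

end LaxLemmas

/-! ### Lax structure maps along a word -/

section LaxWord

open Functor.LaxMonoidal

variable {ι ι' : Type} {C : Type u₁} [Category.{v₁} C] [MonoidalCategory C]
variable {D : Type u₂} [Category.{v₂} D] [MonoidalCategory D]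
variable (F : C ⥤ D) [F.LaxMonoidal]

theorem laxWord_natural {x y : ι → C} (f : ∀ i, x i ⟶ y i) (t : Word ι) :
    t.evalMap (x := F.obj ∘ x) (y := F.obj ∘ y) (fun i => F.map (f i)) ≫ laxWord F y t =
      laxWord F x t ≫ F.map (t.evalMap f) := by
  induction t with
  | unit =>
    refine (Category.id_comp _).trans ((Category.comp_id _).symm.trans ?_)
    exact congrArg (ε F ≫ ·) (F.map_id _).symm
  | var i => exact (Category.comp_id _).trans (Category.id_comp _).symm
  | mul s t hs ht => exact lax_tensor_of_comp F hs ht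

/-- The structure map of a composite word is applied first inside the substituted words and then
along the outer word; for products this is naturality of `μ`. -/
theorem laxWord_subst (x : ι' → C) (w : ι → Word ι') (t : Word ι) :
    laxWord F x (t.subst w) ≫ F.map (t.substIso x w).hom =
      (t.substIso (F.obj ∘ x) w).hom ≫
        t.evalMap (y := F.obj ∘ fun i => (w i).eval x) (fun i => laxWord F x (w i)) ≫
          laxWord F (fun i => (w i).eval x) t := by
  induction t with
  | unit =>
    refine (congrArg (ε F ≫ ·) (F.map_id _)).trans ((Category.comp_id _).trans ?_)
    exact ((Category.id_comp _).trans (Category.id_comp _)).symm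
  | var i =>
    refine (congrArg (laxWord F x (w i) ≫ ·) (F.map_id _)).trans ((Category.comp_id _).trans ?_)
    exact ((Category.id_comp _).trans (Category.comp_id _)).symm
  | mul s t hs ht => exact lax_subst_tensor F hs ht

theorem laxWord_rename (x : ι' → C) (e : ι → ι') (t : Word ι) :
    (t.renameIso (F.obj ∘ x) e).hom ≫ laxWord F (x ∘ e) t =
      laxWord F x (t.rename e) ≫ F.map (t.renameIso x e).hom := by
  have h := laxWord_subst F x (fun i => .var (e i)) t
  have h' : t.evalMap (x := F.obj ∘ x ∘ e) (y := F.obj ∘ x ∘ e)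
    (fun i => laxWord F x (.var (e i))) = 𝟙 _ := t.evalMap_id _
  exact ((congrArg (_ ≫ ·) ((congrArg (· ≫ laxWord F (x ∘ e) t) h').trans
    (Category.id_comp _))).symm.trans h.symm)

theorem laxWord_comp {E : Type u} [Category.{v} E] [MonoidalCategory E] (G : D ⥤ E)
    [G.LaxMonoidal] (x : ι → C) (t : Word ι) :
    laxWord (F ⋙ G) x t = laxWord G (F.obj ∘ x) t ≫ G.map (laxWord F x t) := by
  induction t with
  | unit => rfl
  | var i => exact (congrArg (𝟙 _ ≫ ·) (G.map_id _) |>.trans (Category.comp_id _)).symm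
  | mul s t hs ht =>
    have h : laxWord (F ⋙ G) x (.mul s t) = (laxWord (F ⋙ G) x s ⊗ₘ laxWord (F ⋙ G) x t) ≫
      μ G (F.obj (s.eval x)) (F.obj (t.eval x)) ≫ G.map (μ F (s.eval x) (t.eval x)) := rfl
    rw [h, hs, ht]
    exact lax_comp_mul G _ _ _ _ _

theorem laxWord_id (x : ι → C) (t : Word ι) : laxWord (𝟭 C) x t = 𝟙 (t.eval x) := by
  induction t with
  | unit => rfl
  | var i => rfl
  | mul s t hs ht =>
    have h : laxWord (𝟭 C) x (.mul s t) = (laxWord (𝟭 C) x s ⊗ₘ laxWord (𝟭 C) x t) ≫ 𝟙 _ := rfl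
    rw [h, hs, ht]
    exact (Category.comp_id _).trans (id_tensorHom_id _ _)

end LaxWord

/-! ### The multifunctor of a lax symmetric monoidal functor -/

section LaxBraided

open Functor.LaxMonoidal

variable {ι ι' : Type} {C : Type u₁} [Category.{v₁} C] [MonoidalCategory C] [SymmetricCategory C]
variable {D : Type u₂} [Category.{v₂} D] [MonoidalCategory D] [SymmetricCategory D]

theorem lax_braiding (F : C ⥤ D) [F.LaxBraided] {a b : D} {a' b' : C} (p : a ⟶ F.obj a')
    (q : b ⟶ F.obj b') :
    (β_ a b).hom ≫ (q ⊗ₘ p) ≫ μ F b' a' = ((p ⊗ₘ q) ≫ μ F a' b') ≫ F.map (β_ a' b').hom := by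
  rw [Category.assoc, Functor.LaxBraided.braided, BraidedCategory.braiding_naturality_assoc]

/-- On generators these are the associativity, unit and symmetry axioms of a lax functor, or the
same squares with both isomorphisms inverted. -/
theorem laxWord_coh (F : C ⥤ D) [F.LaxBraided] (x : ι → C) {s t : Word ι} (c : Coh s t) :
    c.eval (F.obj ∘ x) ≫ laxWord F x t = laxWord F x s ≫ F.map (c.eval x) := by
  induction c with
  | ident s =>
    refine (Category.id_comp _).trans ((Category.comp_id _).symm.trans ?_)
    exact congrArg (laxWord F x s ≫ ·) (F.map_id _).symm
  | comp f g hf hg => exact lax_comp_of_comp F hf hg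
  | tensor f g hf hg => exact lax_tensor_of_comp F hf hg
  | assoc s t w => exact lax_associator F _ _ _
  | assocInv s t w =>
    exact lax_inv F (i := α_ _ _ _) (i' := α_ (s.eval x) (t.eval x) (w.eval x))
      (lax_associator F _ _ _)
  | leftUnit s => exact lax_leftUnitor F _
  | leftUnitInv s =>
    exact lax_inv F (i := λ_ _) (i' := λ_ (s.eval x)) (lax_leftUnitor F _)
  | rightUnit s => exact lax_rightUnitor F _
  | rightUnitInv s =>
    exact lax_inv F (i := ρ_ _) (i' := ρ_ (s.eval x)) (lax_rightUnitor F _)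
  | braid s t => exact lax_braiding F _ _

theorem IsCan.laxWord (F : C ⥤ D) [F.LaxBraided] {e : ι → ι'} {x : ι' → C} {s : Word ι}
    {t : Word ι'} {m} (hm : IsCan e x s t m) :
    ∃ m', IsCan e (F.obj ∘ x) s t m' ∧
      m' ≫ laxWord F x t = laxWord F (x ∘ e) s ≫ F.map m := by
  obtain ⟨c, rfl⟩ := hm
  exact ⟨_, ⟨c, rfl⟩, lax_comp_of_comp F
    (lax_inv F (laxWord_rename F x e s)) (laxWord_coh F x c)⟩

/-- On representatives the induced map is independent of `κ` and `ν`. Multifunctoriality and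
functoriality in `F` are then checked on representatives only. -/
theorem Rep.laxMap {κ : Choice C} (ν : Choice D) (F : LaxBraidedFunctor C D) {n : ℕ} {e : Fin n → ι}
    {X : ι → C} {t : Word ι} {z : C} {f : t.eval X ⟶ z} {g} (h : Rep κ e X t f g) :
    Rep ν e (F.obj ∘ X) t (laxWord F.toFunctor X t ≫ F.map f)
      ((laxMap κ ν F).map (x := X ∘ e) g) := by
  obtain ⟨m, hm, rfl⟩ := h
  obtain ⟨m', hm', h⟩ := hm.laxWord F.toFunctor
  have h' := IsCan.of_coh (F.obj ∘ X ∘ e)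
    (Y.nonempty_coh (ν n (F.obj ∘ X ∘ e)) (κ n (X ∘ e))).some
  exact ⟨_, h'.comp hm', lax_map_eq F.toFunctor h⟩

theorem isMultifunctor_laxMap (κ : Choice C) (ν : Choice D) (F : LaxBraidedFunctor C D) :
    IsMultifunctor (laxMap κ ν F) where
  map_ident a := by
    have h := (Rep.ident (κ := κ) (fun _ : Fin 1 => a) 0).laxMap ν F
    have h' := Rep.ident (κ := ν) (fun _ : Fin 1 => F.obj a) 0
    exact h.unique (h'.congr ((Category.id_comp _).trans (F.map_id a)).symm)
      (List.nodup_singleton _)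
  map_perm {n x y} σ f :=
    (((Rep.self (κ := κ) x f).perm σ).laxMap ν F).unique
      (((Rep.self (κ := κ) x f).laxMap ν F).perm σ) (κ n x).2.1
  map_comp {n k x y z} f g := by
    let i : ∀ s, Fin (k s) → Σ s, Fin (k s) := fun s r => ⟨s, r⟩
    let X : (Σ s, Fin (k s)) → C := fun p => x p.1 p.2
    let w : Fin n → Word (Σ s, Fin (k s)) := fun s => (κ (k s) (x s)).1.rename (i s)
    let g' : ∀ s, (w s).eval X ⟶ y s := fun s => ((κ (k s) (x s)).1.renameIso X (i s)).hom ≫ g s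
    have hg : ∀ s, Rep κ (i s) X (w s) (g' s) (g s) := fun s => Rep.rename (i s) X (g s)
    have h := (Rep.self (κ := κ) y f).comp hg
    have h' := ((Rep.self (κ := κ) y f).laxMap ν F).comp
      (g := fun s => laxWord F.toFunctor X (w s) ≫ F.map (g' s)) (fun s => (hg s).laxMap ν F)
    refine (h.laxMap ν F).unique (h'.congr ?_) (h.enumerates (concat_injective ?_)).1
    · have h₁ := laxWord_subst F.toFunctor X w (κ n y).1
      have h₂ := laxWord_natural F.toFunctor g' (κ n y).1
      have h₃ := (κ n y).1.evalMap_comp (z := F.obj ∘ y) (fun s => laxWord F.toFunctor X (w s))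
        (fun s => F.map (g' s))
      exact lax_multicomp_eq F.toFunctor h₁ h₂ h₃
    · exact Function.injective_id

theorem laxMap_id (κ : Choice C) {n : ℕ} {x : Fin n → C} {y : C} (f : κ.bar x ⟶ y) :
    (laxMap κ κ (LaxBraidedFunctor.of (𝟭 C))).map (x := x) f = f := by
  have h := (Rep.self (κ := κ) x f).laxMap κ (LaxBraidedFunctor.of (𝟭 C))
  exact h.unique ((Rep.self x f).congr
    ((congrArg (· ≫ f) (laxWord_id x _)).trans (Category.id_comp f)).symm) (κ n x).2.1

theorem laxMap_comp {E : Type u} [Category.{v} E] [MonoidalCategory E] [SymmetricCategory E]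
    (κ : Choice C) (ν : Choice D) (ξ : Choice E)
    (F : LaxBraidedFunctor C D) (G : LaxBraidedFunctor D E) {n : ℕ} {x : Fin n → C} {y : C}
    (f : κ.bar x ⟶ y) :
    (laxMap κ ξ (LaxBraidedFunctor.of (F.toFunctor ⋙ G.toFunctor))).map (x := x) f =
      (laxMap ν ξ G).map (x := F.obj ∘ x) ((laxMap κ ν F).map (x := x) f) := by
  have h := (Rep.self (κ := κ) x f).laxMap ξ (LaxBraidedFunctor.of (F.toFunctor ⋙ G.toFunctor))
  have h' := ((Rep.self (κ := κ) x f).laxMap ν F).laxMap ξ G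
  exact h.unique (h'.congr (lax_comp_eq G.toFunctor (laxWord_comp F.toFunctor G.toFunctor x _)))
    (κ n x).2.1

end LaxBraided

/-! ## Multifunctors come from lax symmetric monoidal functors -/

section TensorLemmas

variable {C : Type u} [Category.{v} C] [MonoidalCategory C]

theorem id_tensor_comp {a b a' b' c : C} (f : a ⟶ a') (g : b ⟶ b') (h : a' ⊗ b' ⟶ c) :
    (𝟙 a ⊗ₘ 𝟙 b) ≫ (f ⊗ₘ g) ≫ h = (f ⊗ₘ g) ≫ h := by
  simp

theorem id_tensor_comp_comp_id {a b a' b' : C} (f : a ⟶ a') (g : b ⟶ b') :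
    (𝟙 a ⊗ₘ 𝟙 b) ≫ (f ⊗ₘ g) ≫ 𝟙 (a' ⊗ b') = f ⊗ₘ g := by
  simp

theorem id_comp_tensor_id_comp {a b a' b' : C} (f : a ⟶ a') (g : b ⟶ b') :
    ((𝟙 a ≫ f) ⊗ₘ (𝟙 b ≫ g)) = 𝟙 (a ⊗ b) ≫ (f ⊗ₘ g) := by
  simp

theorem id_comp_tensor_id_comp_assoc {a b a' b' c : C} (f : a ⟶ a') (g : b ⟶ b')
    (h : a' ⊗ b' ⟶ c) : ((𝟙 a ≫ f) ⊗ₘ (𝟙 b ≫ g)) ≫ h = (f ⊗ₘ g) ≫ h := by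
  simp

theorem id_tensor_id_comp {a b c : C} (f : a ⊗ b ⟶ c) : (𝟙 a ⊗ₘ 𝟙 b) ≫ f = f := by
  simp

theorem comp_id_tensor_id {a b c : C} (f : c ⟶ a ⊗ b) : f ≫ (𝟙 a ⊗ₘ 𝟙 b) = f := by
  simp

theorem comp_id_tensor_id_comp {a b c d : C} (f : c ⟶ a ⊗ b) (g : a ⊗ b ⟶ d) :
    f ≫ (𝟙 a ⊗ₘ 𝟙 b) ≫ g = f ≫ g := by
  simp

theorem id_tensor_id_tensor_id_comp {a b c d : C} (f : (a ⊗ b) ⊗ c ⟶ d) :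
    ((𝟙 a ⊗ₘ 𝟙 b) ⊗ₘ 𝟙 c) ≫ f = f := by
  simp

theorem comp_id_tensor_id_tensor_id {a b c d : C} (f : d ⟶ a ⊗ (b ⊗ c)) :
    f ≫ (𝟙 a ⊗ₘ (𝟙 b ⊗ₘ 𝟙 c)) = f := by
  simp

theorem carry_assoc_left {a b c d e f : C} (p : a ⊗ b ⟶ d) (q : d ⊗ c ⟶ e) (r : e ⟶ f) :
    ((((𝟙 a ⊗ₘ 𝟙 b) ≫ p) ⊗ₘ 𝟙 c) ≫ q) ≫ r = p ▷ c ≫ q ≫ r := by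
  simp

theorem carry_assoc_right {a b c d e f : C} (r : f ⟶ a ⊗ (b ⊗ c)) (p : b ⊗ c ⟶ d)
    (q : a ⊗ d ⟶ e) :
    r ≫ (𝟙 a ⊗ₘ ((𝟙 b ⊗ₘ 𝟙 c) ≫ p)) ≫ q = r ≫ a ◁ p ≫ q := by
  simp

theorem carry_unit_left {a b c d e : C} (p : a ⟶ b) (q : b ⊗ c ⟶ d) (r : d ⟶ e) :
    ((p ⊗ₘ 𝟙 c) ≫ q) ≫ r = p ▷ c ≫ q ≫ r := by
  simp

theorem carry_unit_right {a b c d e : C} (p : a ⟶ b) (q : c ⊗ b ⟶ d) (r : d ⟶ e) :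
    ((𝟙 c ⊗ₘ p) ≫ q) ≫ r = c ◁ p ≫ q ≫ r := by
  simp

theorem laxWord_pair_id {D : Type u₁} [Category.{v₁} D] [MonoidalCategory D] (F : C ⥤ D) [F.LaxMonoidal] (a b : C) :
    ((𝟙 (F.obj a) ⊗ₘ 𝟙 (F.obj b)) ≫ Functor.LaxMonoidal.μ F a b) ≫ F.map (𝟙 (a ⊗ b)) =
      Functor.LaxMonoidal.μ F a b := by
  simp

end TensorLemmas

/-! ### Enumerations of the letters of a word -/

section Enumerates

variable {ι : Type}

theorem Word.exists_enumerates {t : Word ι} (ht : t.letters.Nodup) :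
    ∃ (n : ℕ) (e : Fin n → ι), Enumerates e t :=
  ⟨_, t.letters.get, ht, by
    rw [← List.ofFn_eq_map, List.ofFn_get]⟩

theorem Enumerates.exists_perm {n : ℕ} {e e' : Fin n → ι} {t : Word ι} (h : Enumerates e t)
    (h' : ((List.finRange n).map e').Perm t.letters) :
    ∃ σ : Equiv.Perm (Fin n), e' = e ∘ σ := by
  have inj : Function.Injective e' := by
    have := h'.nodup_iff.2 h.1
    rwa [← List.ofFn_eq_map, List.nodup_ofFn] at this
  have hmem : ∀ i, ∃ j, e j = e' i := fun i => by
    have : e' i ∈ (List.finRange n).map e :=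
      h.2.mem_iff.2 (h'.mem_iff.1 (List.mem_map.2 ⟨i, List.mem_finRange i, rfl⟩))
    obtain ⟨j, -, hj⟩ := List.mem_map.1 this
    exact ⟨j, hj⟩
  choose σ hσ using hmem
  have hσ' : Function.Injective σ := fun i j hij => inj (by rw [← hσ i, ← hσ j, hij])
  exact ⟨Equiv.ofBijective σ (Finite.injective_iff_bijective.1 hσ'), (funext hσ).symm⟩

end Enumerates

/-! ### The action of a multifunctor on representing morphisms -/

section Carries

variable {ι ι' : Type} {C : Type u₁} [Category.{v₁} C] [MonoidalCategory C] [SymmetricCategory C]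
variable {D : Type u₂} [Category.{v₂} D] [MonoidalCategory D] [SymmetricCategory D]
variable {κ : Choice C} {ν : Choice D}

theorem Rep.letters_perm {n : ℕ} {e : Fin n → ι} {X : ι → C} {t : Word ι} {z : C}
    {f : t.eval X ⟶ z} {g} (h : Rep κ e X t f g) : ((List.finRange n).map e).Perm t.letters := by
  obtain ⟨m, hm, -⟩ := h
  exact ((κ n (X ∘ e)).letters_perm.map e).trans hm.letters_perm

/-- The map on objects. -/
def MultiMap.onObj (φ : MultiMap (U κ) (U ν)) : C → D := φ.obj

/-- The map on multimorphisms. -/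
def MultiMap.onHom (φ : MultiMap (U κ) (U ν)) {n : ℕ} (x : Fin n → C) {z : C} (g : κ.bar x ⟶ z) :
    ν.bar (φ.onObj ∘ x) ⟶ φ.onObj z :=
  φ.map (x := x) g

variable {φ : MultiMap (U κ) (U ν)}

variable (φ) in
/-- `φ` takes the multimorphisms represented by `f` to those represented by `f'`. -/
def Carries (X : ι → C) (t : Word ι) {z : C} (f : t.eval X ⟶ z)
    (f' : t.eval (φ.onObj ∘ X) ⟶ φ.onObj z) : Prop :=
  ∀ ⦃n : ℕ⦄ (e : Fin n → ι) (g : κ.bar (X ∘ e) ⟶ z), Rep κ e X t f g →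
    Rep ν e (φ.onObj ∘ X) t f' (φ.onHom (X ∘ e) g)

variable {X : ι → C} {t : Word ι} {z : C}

theorem Carries.congr {f₁ f₂ : t.eval X ⟶ z} {f₁' f₂'} (h : Carries φ X t f₁ f₁') (hf : f₁ = f₂)
    (hf' : f₁' = f₂') : Carries φ X t f₂ f₂' :=
  hf ▸ hf' ▸ h

theorem Carries.unique {f : t.eval X ⟶ z} {f' f''} (h : Carries φ X t f f')
    (h' : Carries φ X t f f'') (ht : t.letters.Nodup) : f' = f'' := by
  obtain ⟨n, e, he⟩ := Word.exists_enumerates ht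
  obtain ⟨g, hg⟩ := he.exists_rep κ f
  exact (h e g hg).unique_left (h' e g hg) ht

/-- One enumeration suffices: any other differs from it by a permutation, and `φ` is equivariant. -/
theorem Carries.of_rep (hφ : IsMultifunctor φ) {n : ℕ} {e : Fin n → ι} {f : t.eval X ⟶ z} {f' g}
    (ht : t.letters.Nodup) (h : Rep κ e X t f g)
    (h' : Rep ν e (φ.onObj ∘ X) t f' (φ.onHom (X ∘ e) g)) : Carries φ X t f f' := by
  intro n' e' g' hg'
  obtain rfl : n = n' := by
    simpa using (h.letters_perm.trans hg'.letters_perm.symm).length_eq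
  obtain ⟨σ, rfl⟩ := Enumerates.exists_perm ⟨ht, h.letters_perm⟩ hg'.letters_perm
  obtain rfl := hg'.unique (h.perm σ) ht
  have h₁ : φ.onHom (X ∘ e ∘ σ) ((U κ).perm (x := X ∘ e) σ g) =
    (U ν).perm (x := φ.onObj ∘ X ∘ e) σ (φ.onHom (X ∘ e) g) := hφ.map_perm σ g
  have h₂ := h'.perm σ
  rw [h₁]
  exact h₂

theorem exists_carries (hφ : IsMultifunctor φ) (ht : t.letters.Nodup) (f : t.eval X ⟶ z) :
    ∃ f', Carries φ X t f f' := by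
  obtain ⟨n, e, he⟩ := Word.exists_enumerates ht
  obtain ⟨g, hg⟩ := he.exists_rep κ f
  obtain ⟨f', hf'⟩ := he.exists_represents (X := φ.onObj ∘ X) (φ.onHom (X ∘ e) g)
  exact ⟨f', .of_rep hφ ht hg hf'⟩

theorem Carries.ident (hφ : IsMultifunctor φ) (X : ι → C) (i : ι) :
    Carries φ X (.var i) (𝟙 (X i)) (𝟙 (φ.onObj (X i))) := by
  refine .of_rep hφ (List.nodup_singleton _) (Rep.ident X i) ?_
  have h : φ.onHom (fun _ : Fin 1 => X i) ((U κ).ident (X i)) = (U ν).ident (φ.onObj (X i)) :=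
    hφ.map_ident (X i)
  have h' := Rep.ident (κ := ν) (φ.onObj ∘ X) i
  exact Eq.mpr (congrArg (Rep ν (fun _ : Fin 1 => i) (φ.onObj ∘ X) (.var i) (𝟙 _)) h) h'

/-- Preservation of multicomposition, read on representatives through `Rep.comp`. -/
theorem Carries.subst (hφ : IsMultifunctor φ) {t : Word ι'} {w : ι' → Word ι} {y : ι' → C}
    {f : t.eval y ⟶ z} {f'} {g : ∀ i, (w i).eval X ⟶ y i} {g'}
    (ht : t.letters.Nodup) (hw : ∀ i, (w i).letters.Nodup) (htw : (t.subst w).letters.Nodup)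
    (hf : Carries φ y t f f') (hg : ∀ i, Carries φ X (w i) (g i) (g' i)) :
    Carries φ X (t.subst w) ((t.substIso X w).hom ≫ t.evalMap g ≫ f)
      ((t.substIso (φ.onObj ∘ X) w).hom ≫ t.evalMap (y := φ.onObj ∘ y) g' ≫ f') := by
  obtain ⟨n, d, hd⟩ := Word.exists_enumerates ht
  choose k E hE using fun i => Word.exists_enumerates (hw i)
  obtain ⟨F, hF⟩ := hd.exists_rep κ f
  choose G hG using fun i => (hE i).exists_rep κ (g i)
  have h₁ := hF.comp (k := fun s => k (d s)) (fun s => hG (d s))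
  have h₂ := (hf _ _ hF).comp (k := fun s => k (d s)) (g := g') (fun s => hg (d s) _ _ (hG (d s)))
  refine .of_rep hφ htw h₁ ?_
  have h₃ := hφ.map_comp (k := fun s => k (d s)) (x := fun s => X ∘ E (d s)) (y := y ∘ d) F
    (fun s => G (d s))
  exact Eq.mpr (congrArg (Rep ν (concat fun s => E (d s)) (φ.onObj ∘ X) (t.subst w) _) h₃) h₂

/-- Changing the word along a formal composite changes the representatives on both sides but not the
multimorphisms, so no property of `φ` enters. -/
theorem Carries.coh {s : Word ι} {f : t.eval X ⟶ z} {f'} (h : Carries φ X t f f') (c : Coh s t) :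
    Carries φ X s (c.eval X ≫ f) (c.eval (φ.onObj ∘ X) ≫ f') := by
  intro n e g hg
  have h₁ := h e g (hg.of_isCan (a := id) (IsCan.of_coh X c) rfl)
  exact h₁.of_isCan (a := id) (IsCan.of_coh (φ.onObj ∘ X) c.symm)
    (((c.evalIso (φ.onObj ∘ X)).inv_hom_id_assoc f').symm)

/-! ### Reconstruction of the functor -/

variable (hφ : IsMultifunctor φ)

/-- The action on morphisms of the functor that underlies a multifunctor. -/
noncomputable def IsMultifunctor.onMor {a b : C} (f : a ⟶ b) : φ.onObj a ⟶ φ.onObj b :=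
  (exists_carries hφ (X := fun _ : Unit => a) (t := .var ()) (List.nodup_singleton _) f).choose

/-- The unit of the lax monoidal functor that underlies a multifunctor. -/
noncomputable def IsMultifunctor.unitHom : 𝟙_ D ⟶ φ.onObj (𝟙_ C) :=
  (exists_carries hφ (X := Empty.elim) (t := .unit) List.nodup_nil (𝟙 (𝟙_ C))).choose

theorem pairWord_nodup : (Word.mul (.var true) (.var false)).letters.Nodup := by
  simp [Word.letters]

/-- The tensorator of the lax monoidal functor that underlies a multifunctor. -/
noncomputable def IsMultifunctor.tensorMap (a b : C) :
    φ.onObj a ⊗ φ.onObj b ⟶ φ.onObj (a ⊗ b) :=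
  (exists_carries hφ (X := fun i => cond i a b) (t := .mul (.var true) (.var false))
    pairWord_nodup (𝟙 (a ⊗ b))).choose

theorem IsMultifunctor.carries_onMor {a b : C} (f : a ⟶ b) :
    Carries φ (fun _ : Unit => a) (.var ()) f (hφ.onMor f) :=
  (exists_carries hφ (X := fun _ : Unit => a) (t := .var ()) (List.nodup_singleton _)
    f).choose_spec

theorem IsMultifunctor.carries_unitHom' :
    Carries φ Empty.elim .unit (𝟙 (𝟙_ C)) hφ.unitHom :=
  (exists_carries hφ (X := Empty.elim) (t := .unit) List.nodup_nil (𝟙 (𝟙_ C))).choose_spec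

theorem IsMultifunctor.carries_tensorMap (a b : C) :
    Carries φ (fun i => cond i a b) (.mul (.var true) (.var false)) (𝟙 (a ⊗ b))
      (hφ.tensorMap a b) :=
  (exists_carries hφ (X := fun i => cond i a b) (t := .mul (.var true) (.var false))
    pairWord_nodup (𝟙 (a ⊗ b))).choose_spec

/-- The unit map was chosen over the empty alphabet; substitution into the unit word carries it to
every alphabet. -/
theorem IsMultifunctor.carries_unitHom (X : ι → C) :
    Carries φ X .unit (𝟙 (𝟙_ C)) hφ.unitHom := by
  have h := Carries.subst hφ (t := .unit) (X := X) (w := Empty.elim) (g := fun i => i.elim) (g' := fun i => i.elim)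
    List.nodup_nil (fun i => i.elim) List.nodup_nil hφ.carries_unitHom' (fun i => i.elim)
  exact h.congr ((Category.id_comp (𝟙 (𝟙_ C) ≫ 𝟙 (𝟙_ C))).trans (Category.id_comp _))
    ((Category.id_comp (𝟙 (𝟙_ D) ≫ hφ.unitHom)).trans (Category.id_comp _))

/-- Substitution of `t` into a one-letter word. -/
theorem Carries.comp_onMor {f : t.eval X ⟶ z} {f'} (h : Carries φ X t f f') (ht : t.letters.Nodup)
    {z' : C} (g : z ⟶ z') : Carries φ X t (f ≫ g) (f' ≫ hφ.onMor g) := by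
  have h := Carries.subst hφ (t := .var ()) (X := X) (w := fun _ => t) (g := fun _ => f) (g' := fun _ => f')
    (List.nodup_singleton ()) (fun _ => ht) ht (hφ.carries_onMor g) (fun _ => h)
  exact h.congr (Category.id_comp (f ≫ g)) (Category.id_comp (f' ≫ hφ.onMor g))

/-- Substitution of `s` and `t` into the two-letter product that defines the tensorator. -/
theorem Carries.mul {s : Word ι} {z' : C} {f : s.eval X ⟶ z} {f'} {g : t.eval X ⟶ z'} {g'}
    (hf : Carries φ X s f f') (hg : Carries φ X t g g')
    (hst : (Word.mul s t).letters.Nodup) :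
    Carries φ X (.mul s t) (f ⊗ₘ g) ((f' ⊗ₘ g') ≫ hφ.tensorMap z z') := by
  have h := Carries.subst hφ (X := X) (w := fun i => cond i s t) (y := fun i => cond i z z')
    (g := fun i => match i with | true => f | false => g)
    (g' := fun i => match i with | true => f' | false => g')
    pairWord_nodup
    (fun i => match i with
      | true => (List.nodup_append.1 hst).1
      | false => (List.nodup_append.1 hst).2.1) hst (hφ.carries_tensorMap z z')
    (fun i => match i with | true => hf | false => hg)
  exact h.congr (id_tensor_comp_comp_id f g) (id_tensor_comp f' g' (hφ.tensorMap z z'))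

theorem IsMultifunctor.onMor_id (a : C) : hφ.onMor (𝟙 a) = 𝟙 (φ.onObj a) :=
  (hφ.carries_onMor (𝟙 a)).unique (Carries.ident hφ _ ()) (List.nodup_singleton _)

theorem IsMultifunctor.onMor_comp {a b c : C} (f : a ⟶ b) (g : b ⟶ c) :
    hφ.onMor (f ≫ g) = hφ.onMor f ≫ hφ.onMor g :=
  (hφ.carries_onMor (f ≫ g)).unique ((hφ.carries_onMor f).comp_onMor hφ (List.nodup_singleton _) g)
    (List.nodup_singleton _)

theorem IsMultifunctor.tensorMap_natural {a a' b b' : C} (f : a ⟶ a') (g : b ⟶ b') :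
    (hφ.onMor f ⊗ₘ hφ.onMor g) ≫ hφ.tensorMap a' b' = hφ.tensorMap a b ≫ hφ.onMor (f ⊗ₘ g) := by
  let X : Bool → C := fun i => cond i a b
  have hf := (Carries.ident hφ X true).comp_onMor hφ (List.nodup_singleton _) f
  have hg := (Carries.ident hφ X false).comp_onMor hφ (List.nodup_singleton _) g
  have h := (hφ.carries_tensorMap a b).comp_onMor hφ pairWord_nodup (f ⊗ₘ g)
  refine ((hf.mul hφ hg pairWord_nodup).congr (f₂ := 𝟙 (a ⊗ b) ≫ (f ⊗ₘ g)) ?_ ?_).unique h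
    pairWord_nodup
  · exact id_comp_tensor_id_comp f g
  · exact id_comp_tensor_id_comp_assoc _ _ _

/-- Both sides represent the image under `φ` of the associator of `C`, which is reached once by
postcomposition and once as a change of word. The unit and symmetry axioms are proved in the same
way. -/
theorem IsMultifunctor.tensorMap_assoc (a b c : C) :
    (hφ.tensorMap a b ▷ φ.onObj c) ≫ hφ.tensorMap (a ⊗ b) c ≫ hφ.onMor (α_ a b c).hom =
      (α_ (φ.onObj a) (φ.onObj b) (φ.onObj c)).hom ≫ φ.onObj a ◁ hφ.tensorMap b c ≫
        hφ.tensorMap a (b ⊗ c) := by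
  -- Three distinct letters label the objects, so uniqueness applies even if some of `a`, `b`, `c`
  -- are equal.
  let X : Fin 3 → C := ![a, b, c]
  have h := fun i => Carries.ident hφ X i
  have hn : (Word.mul (.mul (.var (0 : Fin 3)) (.var 1)) (.var 2)).letters.Nodup := by decide
  have hn₁ : (Word.mul (.var (0 : Fin 3)) (.var 1)).letters.Nodup := by decide
  have hn₂ : (Word.mul (.var (1 : Fin 3)) (.var 2)).letters.Nodup := by decide
  have hn₃ : (Word.mul (.var (0 : Fin 3)) (.mul (.var 1) (.var 2))).letters.Nodup := by decide
  have h₁ := (((h 0).mul hφ (h 1) hn₁).mul hφ (h 2) hn).comp_onMor hφ hn (α_ a b c).hom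
  have h₂ := ((h 0).mul hφ ((h 1).mul hφ (h 2) hn₂) hn₃).coh (.assoc (.var 0) (.var 1) (.var 2))
  refine (h₁.congr (f₂ := (α_ a b c).hom) ?_ ?_).unique (h₂.congr ?_ ?_) hn
  · exact id_tensor_id_tensor_id_comp (α_ a b c).hom
  · exact carry_assoc_left (hφ.tensorMap a b) _ _
  · exact comp_id_tensor_id_tensor_id (α_ a b c).hom
  · exact carry_assoc_right _ (hφ.tensorMap b c) _

theorem IsMultifunctor.leftUnitor (a : C) :
    (λ_ (φ.onObj a)).hom = hφ.unitHom ▷ φ.onObj a ≫ hφ.tensorMap (𝟙_ C) a ≫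
      hφ.onMor (λ_ a).hom := by
  have h := Carries.ident hφ (fun _ : Unit => a) ()
  have h₁ := ((hφ.carries_unitHom (fun _ : Unit => a)).mul hφ h (List.nodup_singleton _)).comp_onMor
    hφ (List.nodup_singleton _) (λ_ a).hom
  have h₂ := h.coh (.leftUnit (.var ()))
  refine (h₂.congr (f₂ := (λ_ a).hom) (Category.comp_id _) (Category.comp_id _)).unique
    (h₁.congr ?_ ?_) (List.nodup_singleton _)
  · exact id_tensor_id_comp _
  · exact carry_unit_left _ _ _

theorem IsMultifunctor.rightUnitor (a : C) :
    (ρ_ (φ.onObj a)).hom = φ.onObj a ◁ hφ.unitHom ≫ hφ.tensorMap a (𝟙_ C) ≫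
      hφ.onMor (ρ_ a).hom := by
  have h := Carries.ident hφ (fun _ : Unit => a) ()
  have h₁ := (h.mul hφ (hφ.carries_unitHom (fun _ : Unit => a)) (List.nodup_singleton _)).comp_onMor
    hφ (List.nodup_singleton _) (ρ_ a).hom
  have h₂ := h.coh (.rightUnit (.var ()))
  refine (h₂.congr (f₂ := (ρ_ a).hom) (Category.comp_id _) (Category.comp_id _)).unique
    (h₁.congr ?_ ?_) (List.nodup_singleton _)
  · exact id_tensor_id_comp _
  · exact carry_unit_right _ _ _

theorem IsMultifunctor.braiding (a b : C) :
    hφ.tensorMap a b ≫ hφ.onMor (β_ a b).hom =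
      (β_ (φ.onObj a) (φ.onObj b)).hom ≫ hφ.tensorMap b a := by
  let X : Bool → C := fun i => cond i a b
  have h := fun i => Carries.ident hφ X i
  have hn : (Word.mul (.var false) (.var true)).letters.Nodup := by decide
  have h₁ := (hφ.carries_tensorMap a b).comp_onMor hφ pairWord_nodup (β_ a b).hom
  have h₂ := ((h false).mul hφ (h true) hn).coh (.braid (.var true) (.var false))
  refine (h₁.congr (f₂ := (β_ a b).hom) (Category.id_comp _) rfl).unique
    (h₂.congr ?_ ?_) pairWord_nodup
  · exact comp_id_tensor_id _
  · exact comp_id_tensor_id_comp _ _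

/-- The lax symmetric monoidal functor that underlies a multifunctor. -/
noncomputable def IsMultifunctor.toLaxBraidedFunctor : LaxBraidedFunctor C D where
  obj := φ.onObj
  map f := hφ.onMor f
  map_id a := hφ.onMor_id a
  map_comp f g := hφ.onMor_comp f g
  laxBraided :=
    { ε := hφ.unitHom
      μ := hφ.tensorMap
      μ_natural_left := fun f c => by
        have := hφ.tensorMap_natural f (𝟙 c)
        rwa [hφ.onMor_id, tensorHom_id, tensorHom_id] at this
      μ_natural_right := fun c f => by
        have := hφ.tensorMap_natural (𝟙 c) f
        rwa [hφ.onMor_id, id_tensorHom, id_tensorHom] at this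
      associativity := hφ.tensorMap_assoc
      left_unitality := hφ.leftUnitor
      right_unitality := hφ.rightUnitor
      braided := hφ.braiding }

/-- `laxWord` is assembled from the unit map and the tensorator by the same recursion that builds
the word, so the values of `φ` on identities are determined by these data. -/
theorem IsMultifunctor.carries_laxWord (X : ι → C) {t : Word ι} (ht : t.letters.Nodup) :
    Carries φ X t (𝟙 (t.eval X)) (laxWord hφ.toLaxBraidedFunctor.toFunctor X t) := by
  induction t with
  | unit => exact hφ.carries_unitHom X
  | var i => exact Carries.ident hφ X i
  | mul s t hs ht' =>
    have h := (hs (List.nodup_append.1 ht).1).mul hφ (ht' (List.nodup_append.1 ht).2.1) ht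
    exact h.congr (id_tensorHom_id _ _) rfl

theorem IsMultifunctor.laxMap_toLaxBraidedFunctor :
    laxMap κ ν hφ.toLaxBraidedFunctor = φ := by
  refine MultiMap.ext rfl (heq_of_eq ?_)
  funext n x y f
  have h := (hφ.carries_laxWord (X := x) (κ n x).2.1).comp_onMor hφ (κ n x).2.1 f
  -- A multimorphism `f` represents itself on the word chosen by `κ`, so `φ` takes it to the
  -- multimorphism represented by `laxWord` followed by the image of `f`, as `laxMap` does.
  have h₁ := h.congr (Category.id_comp f) rfl id f (Rep.self (κ := κ) x f)
  exact ((Rep.self (κ := κ) x f).laxMap ν hφ.toLaxBraidedFunctor).unique h₁ (κ n x).2.1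

/-! ### Recovering a lax functor from its multifunctor -/

theorem carries_laxMap (F : LaxBraidedFunctor C D) (X : ι → C) (t : Word ι) {z : C}
    (f : t.eval X ⟶ z) :
    Carries (φ := laxMap κ ν F) X t f (laxWord F.toFunctor X t ≫ F.map f) :=
  fun _ _ _ h => h.laxMap ν F

theorem onMor_laxMap (F : LaxBraidedFunctor C D) {a b : C} (f : a ⟶ b) :
    (isMultifunctor_laxMap κ ν F).onMor f = F.map f :=
  (((isMultifunctor_laxMap κ ν F).carries_onMor f).unique
    (carries_laxMap F (fun _ : Unit => a) (.var ()) f) (List.nodup_singleton _)).trans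
    (Category.id_comp (F.map f))

theorem unitHom_laxMap (F : LaxBraidedFunctor C D) :
    (isMultifunctor_laxMap κ ν F).unitHom = F.laxBraided.ε :=
  ((isMultifunctor_laxMap κ ν F).carries_unitHom'.unique
    (carries_laxMap F Empty.elim .unit (𝟙 (𝟙_ C))) List.nodup_nil).trans
    ((congrArg (F.laxBraided.ε ≫ ·) (F.map_id (𝟙_ C))).trans (Category.comp_id F.laxBraided.ε))

theorem tensorMap_laxMap (F : LaxBraidedFunctor C D) (a b : C) :
    (isMultifunctor_laxMap κ ν F).tensorMap a b = F.laxBraided.μ a b := by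
  have h := ((isMultifunctor_laxMap κ ν F).carries_tensorMap a b).unique
    (carries_laxMap F (fun i => cond i a b) (.mul (.var true) (.var false)) (𝟙 (a ⊗ b)))
    pairWord_nodup
  exact h.trans (laxWord_pair_id F.toFunctor a b)

/-- The reconstructed functor has the same object map as `F` by definition, so the remaining data
can be compared without transport. -/
theorem laxBraidedFunctor_ext_of_map {o : C → D} {m m' : ∀ {a b : C}, (a ⟶ b) → (o a ⟶ o b)}
    {h₁ h₂ h₁' h₂'} {F : Functor.LaxBraided (C := C) (D := D) ⟨o, m, h₁, h₂⟩}
    {F' : Functor.LaxBraided (C := C) (D := D) ⟨o, m', h₁', h₂'⟩}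
    (hm : ∀ {a b : C} (f : a ⟶ b), m f = m' f) (hε : F.ε = F'.ε)
    (hμ : ∀ a b, F.μ a b = F'.μ a b) :
    (⟨_, F⟩ : LaxBraidedFunctor C D) = ⟨_, F'⟩ := by
  obtain rfl : @m = @m' := by
    funext a b f
    exact hm f
  exact laxBraidedFunctor_ext hε (funext fun a => funext fun b => hμ a b)

theorem toLaxBraidedFunctor_laxMap (F : LaxBraidedFunctor C D) :
    (isMultifunctor_laxMap κ ν F).toLaxBraidedFunctor = F :=
  laxBraidedFunctor_ext_of_map (F' := F.laxBraided) (fun f => onMor_laxMap F f) (unitHom_laxMap F)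
    (fun a b => tensorMap_laxMap F a b)

variable (κ ν) in
theorem bijective_laxMap : Function.Bijective fun F : LaxBraidedFunctor C D =>
    (⟨laxMap κ ν F, isMultifunctor_laxMap κ ν F⟩ : Multifunctor (U κ) (U ν)) := by
  refine ⟨fun F G h => ?_, fun φ => ⟨φ.isMultifunctor.toLaxBraidedFunctor,
    Multifunctor.ext φ.isMultifunctor.laxMap_toLaxBraidedFunctor⟩⟩
  have h' : laxMap κ ν F = laxMap κ ν G := congrArg Multifunctor.toMultiMap h
  -- The reconstruction depends only on the underlying map, so it is a left inverse of `F ↦ laxMap κ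
  -- ν F`, which gives injectivity.
  have key : ∀ {φ ψ : MultiMap (U κ) (U ν)} (hφ : IsMultifunctor φ) (hψ : IsMultifunctor ψ),
      φ = ψ → hφ.toLaxBraidedFunctor = hψ.toLaxBraidedFunctor := by
    rintro φ _ _ _ rfl
    rfl
  rw [← toLaxBraidedFunctor_laxMap (κ := κ) (ν := ν) F,
    ← toLaxBraidedFunctor_laxMap (κ := κ) (ν := ν) G]
  exact key _ _ h'

end Carries

end SymMult

/-! ### The theorem: fullness and faithfulness are the two halves of bijectivity -/

theorem theorem2p4 :
    (∀ (C : Type u₁) [Category.{v₁} C] [MonoidalCategory C] [SymmetricCategory C]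
      (D : Type u₂) [Category.{v₂} D] [MonoidalCategory D] [SymmetricCategory D]
      (κ : SymMult.Choice C) (ν : SymMult.Choice D),
      SymMult.IsMulticategory (SymMult.U κ) ∧ SymMult.IsMulticategory (SymMult.U ν) ∧
      ∃ h : ∀ F : LaxBraidedFunctor C D, SymMult.IsMultifunctor (SymMult.laxMap κ ν F),
        Function.Bijective
          (fun F : LaxBraidedFunctor C D =>
            (⟨SymMult.laxMap κ ν F, h F⟩ : SymMult.Multifunctor (SymMult.U κ) (SymMult.U ν)))) ∧
    (∀ κ : ∀ C : SymMult.SymMonCat.{u, v}, SymMult.Choice C.carrier,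
      ∃ (hU : ∀ C : SymMult.SymMonCat.{u, v}, SymMult.IsMulticategory (SymMult.U (κ C)))
        (hF : ∀ {C D : SymMult.SymMonCat.{u, v}} (F : C ⟶ D),
          SymMult.IsMultifunctor (SymMult.laxMap (κ C) (κ D) F))
        (hid : ∀ C : SymMult.SymMonCat.{u, v},
          SymMult.laxMap (κ C) (κ C) (𝟙 C) = SymMult.MultiMap.ident (SymMult.U (κ C)))
        (hcomp : ∀ {C D E : SymMult.SymMonCat.{u, v}} (F : C ⟶ D) (G : D ⟶ E),
          SymMult.laxMap (κ C) (κ E) (F ≫ G) =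
            (SymMult.laxMap (κ C) (κ D) F).comp (SymMult.laxMap (κ D) (κ E) G)),
        (SymMult.underlyingFunctor κ hU hF hid hcomp).Full ∧
        (SymMult.underlyingFunctor κ hU hF hid hcomp).Faithful) := by
  refine ⟨fun C _ _ _ D _ _ _ κ ν => ⟨SymMult.isMulticategory_U κ, SymMult.isMulticategory_U ν,
    SymMult.isMultifunctor_laxMap κ ν, SymMult.bijective_laxMap κ ν⟩, fun κ => ?_⟩
  refine ⟨fun C => SymMult.isMulticategory_U (κ C),
    fun {C D} F => SymMult.isMultifunctor_laxMap (κ C) (κ D) F,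
    fun C => SymMult.MultiMap.ext rfl (heq_of_eq ?_),
    fun {C D E} F G => SymMult.MultiMap.ext rfl (heq_of_eq ?_),
    ⟨fun {C D} => (SymMult.bijective_laxMap (κ C) (κ D)).2⟩,
    ⟨fun {C D} _ _ h => (SymMult.bijective_laxMap (κ C) (κ D)).1 h⟩⟩
  · funext n x y f
    exact SymMult.laxMap_id (κ C) f
  · funext n x y f
    exact SymMult.laxMap_comp (κ C) (κ D) (κ E) F G f
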